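/- **The calculus.** Let $x$ range over ordinary variables and $k,l,m$ over continuation variables. The terms $M$ and jumps $J$ of the CCV $\lambda\mu$-calculus are $$M ::= x \mid \lambda x.\,M \mid MM \mid (M\;x{:=}M) \mid \mu k.\,J,\qquad J ::= [k]M \mid (J\;x{:=}M),$$ where $(L\;x{:=}M)$ and $(J\;x{:=}M)$ bind $x$ in $L$ and $J$; they are taken up to $\alpha$-conversion. Values $V$ are variables and $\lambda$-abstractions. Bracketings of the same term are identified by the congruence $\approx$ generated by $(L\;x{:=}(M\;y{:=}N)) = ((L\;x{:=}M)\;y{:=}N)$ if $y\notin FV(L)$; $\;((\mu k.J)\;x{:=}M)=\mu k.(J\;x{:=}M)$ if $k\notin FV(M)$; $\;[k](L\;x{:=}M)=(([k]L)\;x{:=}M)$. **Call-by-value evaluation.** Evaluation acts on bracketed terms: the two sides of the first equation, and of the second, are distinguished, while $(([k]L)\;x{:=}M)$ is always read as $[k](L\;x{:=}M)$. Evaluation contexts are $E::=\square\mid E[V\square]\mid E[\square M]\mid E[(M\;x{:=}\square)]$. The relation $\to_{E_0}$ is given by - $E[(\mu k.J)M]\to_{E_0} E[(zM\;z{:=}\mu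 k.J)]$ and $E[V(\mu k.J)]\to_{E_0} E[(Vz\;z{:=}\mu k.J)]$, with $z$ fresh; - $E[(\lambda x.M)V]\to_{E_0} E[(M\;x{:=}V)]$ and $E[(M\;x{:=}V)]\to_{E_0} E[M\{V/x\}]$; - $E[(M\;x{:=}\mu k.J)]\to_{E_0} E[\mu k.\,J\{[k]\square\mapsto[k](M\;x{:=}\square)\}]$, where every $[k]Q$ in $J$ is recursively replaced by $[k](M\;x{:=}Q)$, bound variables being renamed to avoid capture. The relation $\to_E$ is given by: $\mu k.[l]\mu m.J\to_E\mu k.\,J\{l/m\}$; and, if $L\to_{E_0}M$, then $L\to_E M$ and $\mu k.[l]L\to_E\mu k.[l]M$. The call-by-value evaluation of $M$ terminates if $M\to_E^* N$ for some $N$ that admits no $\to_E$-step. **CPS translation.** $[\![M]\!]=\lambda k.\langle M\rangle[k]$ ($k$ fresh) is an untyped $\lambda$-term, where, for values $V,V_i$ and non-values $N,N_i$, - $\langle V\rangle[K]=KV^*$, $\;\langle V_1V_2\rangle[K]=V_1^*V_2^*K$, $\;\langle VN\rangle[K]=\langle N\rangle[\lambda y.V^*yK]$, $\;\langle NV\rangle[K]=\langle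 N\rangle[\lambda x.xV^*K]$, $\;\langle N_1N_2\rangle[K]=\langle N_1\rangle[\lambda x.\langle N_2\rangle[\lambda y.xyK]]$; - $\langle (L\;x{:=}M)\rangle[K]=\langle M\rangle[\lambda x.\langle L\rangle[K]]$, $\;\langle\mu k.J\rangle[K]=(\lambda k.\langle J\rangle)K$, $\;\langle[k]M\rangle=\langle M\rangle[k]$, $\;\langle (J\;x{:=}M)\rangle=\langle M\rangle[\lambda x.\langle J\rangle]$; - $x^*=x$, $\;(\lambda x.M)^*=\lambda xk.\langle M\rangle[k]$ ($k$ fresh). A $\lambda$-term $t$ is *solvable* if some closure $\lambda x_1\cdots x_n.t$ of it satisfies $(\lambda x_1\cdots x_n.t)u_1\cdots u_m=_\beta\lambda x.x$ for some terms $u_1,\dots,u_m$. It *has a head normal form* if it is $\beta$-equal to a term $\lambda x_1\cdots x_n.\,y\,u_1\cdots u_m$. **Theorem.** Let $M$ be a CCV $\lambda\mu$-term. The call-by-value evaluation of $M$ terminates if and only if $[\![M]\!]$ is solvable, equivalently, if and only if $[\![M]\!]$ has a head normal form. This holds for every choice of bracketing: if $M\approx M'$, then the evaluation of $M$ terminates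 if and only if $[\![M']\!]$ is solvable, if and only if $[\![M']\!]$ has a head normal form. -/

import Mathlib

open Relation

/-! ## Terms and jumps of the CCV lambda-mu-calculus -/

namespace CCV

/- Terms are taken up to alpha-conversion by means of de Bruijn indices. There are two separate
index spaces: one for ordinary variables (bound by `lam`, `letT`, `letJ`) and one for continuation
variables (bound by `mu`). Indices that are not captured by a binder are free variables. -/
mutual
/-- Terms `M ::= x | λx. M | M M | (M x:=M) | μk. J`. In `letT L M`, which stands for
`(L x:=M)`, the ordinary index `0` of the body `L` is bound, and `M` is the argument. -/
inductive Term : Type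
  | var : ℕ → Term
  | lam : Term → Term
  | app : Term → Term → Term
  | letT : Term → Term → Term
  | mu : Jump → Term
/-- Jumps `J ::= [k]M | (J x:=M)`. In `letJ J M` the ordinary index `0` of `J` is bound. -/
inductive Jump : Type
  | jmp : ℕ → Term → Jump
  | letJ : Jump → Term → Jump
end

/-- The extension of a renaming of de Bruijn indices below one binder. -/
def upr (ξ : ℕ → ℕ) : ℕ → ℕ
  | 0 => 0
  | n + 1 => ξ n + 1

mutual
/-- Simultaneous renaming of ordinary variables by `ξ` and of continuation variables by `ζ`. -/
def Term.rename : Term → (ℕ → ℕ) → (ℕ → ℕ) → Term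
  | .var x, ξ, _ => .var (ξ x)
  | .lam M, ξ, ζ => .lam (M.rename (upr ξ) ζ)
  | .app M N, ξ, ζ => .app (M.rename ξ ζ) (N.rename ξ ζ)
  | .letT L M, ξ, ζ => .letT (L.rename (upr ξ) ζ) (M.rename ξ ζ)
  | .mu J, ξ, ζ => .mu (J.rename ξ (upr ζ))
def Jump.rename : Jump → (ℕ → ℕ) → (ℕ → ℕ) → Jump
  | .jmp k M, ξ, ζ => .jmp (ζ k) (M.rename ξ ζ)
  | .letJ J M, ξ, ζ => .letJ (J.rename (upr ξ) ζ) (M.rename ξ ζ)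
end

/-- Weakening by one fresh ordinary variable (the new index `0`). -/
def Term.shiftO (M : Term) : Term := M.rename Nat.succ id

/-- Weakening by one fresh continuation variable (the new index `0`). -/
def Term.shiftC (M : Term) : Term := M.rename id Nat.succ

/-- A term is a value if it is a variable or a lambda-abstraction. -/
def Term.isValue : Term → Bool
  | .var _ => true
  | .lam _ => true
  | _ => false

/-- The extension of a substitution for ordinary variables below a binder of an ordinary
variable. -/
def ups (σ : ℕ → Term) : ℕ → Term
  | 0 => .var 0
  | n + 1 => (σ n).shiftO

mutual
/-- Simultaneous capture-avoiding substitution for the ordinary variables. -/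
def Term.subst : Term → (ℕ → Term) → Term
  | .var x, σ => σ x
  | .lam M, σ => .lam (M.subst (ups σ))
  | .app M N, σ => .app (M.subst σ) (N.subst σ)
  | .letT L M, σ => .letT (L.subst (ups σ)) (M.subst σ)
  | .mu J, σ => .mu (J.subst fun n => (σ n).shiftC)
def Jump.subst : Jump → (ℕ → Term) → Jump
  | .jmp k M, σ => .jmp k (M.subst σ)
  | .letJ J M, σ => .letJ (J.subst (ups σ)) (M.subst σ)
end

/-- `M{V/x}` where `x` is the ordinary index `0` of `M`. -/
def Term.inst (M V : Term) : Term :=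
  M.subst fun
    | 0 => V
    | n + 1 => .var n

/-- `J{l/k}` where `k` is the continuation index `0` of `J`. -/
def Jump.instC (J : Jump) (l : ℕ) : Jump :=
  J.rename id fun
    | 0 => l
    | n + 1 => n

mutual
/-- The context substitution `{[k]□ ↦ [k](M x:=□)}`. Each `[k]Q` is recursively replaced by
`[k](M x:=Q)`; here `x` is the ordinary index `0` of `M`. -/
def Term.ctxSubst : Term → ℕ → Term → Term
  | .var x, _, _ => .var x
  | .lam N, k, M => .lam (N.ctxSubst k (M.rename (upr Nat.succ) id))
  | .app N P, k, M => .app (N.ctxSubst k M) (P.ctxSubst k M)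
  | .letT L N, k, M => .letT (L.ctxSubst k (M.rename (upr Nat.succ) id)) (N.ctxSubst k M)
  | .mu J, k, M => .mu (J.ctxSubst (k + 1) M.shiftC)
def Jump.ctxSubst : Jump → ℕ → Term → Jump
  | .jmp l N, k, M =>
    if l = k then .jmp k (.letT M (N.ctxSubst k M)) else .jmp l (N.ctxSubst k M)
  | .letJ J N, k, M => .letJ (J.ctxSubst k (M.rename (upr Nat.succ) id)) (N.ctxSubst k M)
end

/-! ## The identification of terms that differ only in their bracketing -/

mutual
/-- The congruence generated by the three equality axioms
`(L x:=(M y:=N)) = ((L x:=M) y:=N)` for `y` not free in `L`,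
`((μk.J) x:=M) = μk.(J x:=M)` for `k` not free in `M`, and
`[k](L x:=M) = (([k]L) x:=M)`. -/
inductive Term.BracketEq : Term → Term → Prop
  | refl (M : Term) : Term.BracketEq M M
  | symm {M N : Term} : Term.BracketEq M N → Term.BracketEq N M
  | trans {M N P : Term} : Term.BracketEq M N → Term.BracketEq N P → Term.BracketEq M P
  | lam {M M' : Term} : Term.BracketEq M M' → Term.BracketEq (.lam M) (.lam M')
  | app {M M' N N' : Term} : Term.BracketEq M M' → Term.BracketEq N N' →
      Term.BracketEq (.app M N) (.app M' N')
  | letT {L L' M M' : Term} : Term.BracketEq L L' → Term.BracketEq M M' →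
      Term.BracketEq (.letT L M) (.letT L' M')
  | mu {J J' : Jump} : Jump.BracketEq J J' → Term.BracketEq (.mu J) (.mu J')
  | assoc (L M N : Term) : Term.BracketEq (.letT L (.letT M N))
      (.letT (.letT (L.rename (upr Nat.succ) id) M) N)
  | muLet (J : Jump) (M : Term) : Term.BracketEq (.letT (.mu J) M) (.mu (.letJ J M.shiftC))
inductive Jump.BracketEq : Jump → Jump → Prop
  | refl (J : Jump) : Jump.BracketEq J J
  | symm {J J' : Jump} : Jump.BracketEq J J' → Jump.BracketEq J' J
  | trans {J J' J'' : Jump} : Jump.BracketEq J J' → Jump.BracketEq J' J'' →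
      Jump.BracketEq J J''
  | jmp (k : ℕ) {M M' : Term} : Term.BracketEq M M' → Jump.BracketEq (.jmp k M) (.jmp k M')
  | letJ {J J' : Jump} {M M' : Term} : Jump.BracketEq J J' → Term.BracketEq M M' →
      Jump.BracketEq (.letJ J M) (.letJ J' M')
  | jmpLet (k : ℕ) (L M : Term) : Jump.BracketEq (.jmp k (.letT L M)) (.letJ (.jmp k L) M)
end

/-! ## Call-by-value evaluation -/

mutual
/-- The reading of a term in the operational semantics. The bracketing between lets, and between
`μ` and let, is kept, but every jump is read as `[k]M`, with the jumper outermost: `([k]L) x:=M`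
is understood as `[k](L x:=M)`. -/
def Term.read : Term → Term
  | .var x => .var x
  | .lam M => .lam M.read
  | .app M N => .app M.read N.read
  | .letT L M => .letT L.read M.read
  | .mu J => .mu (.jmp J.read.1 J.read.2)
/-- The continuation variable `k` and the term `M` of the reading `[k]M` of a jump. -/
def Jump.read : Jump → ℕ × Term
  | .jmp k M => (k, M.read)
  | .letJ J M => (J.read.1, .letT J.read.2 M.read)
end

/-- Evaluation contexts `E ::= □ | E[V □] | E[□ M] | E[(M x:=□)]`. -/
inductive EvalCtx : Type
  | hole : EvalCtx
  | argOf (E : EvalCtx) (V : Term) (hV : V.isValue = true) : EvalCtx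
  | funOf (E : EvalCtx) (M : Term) : EvalCtx
  | letOf (E : EvalCtx) (M : Term) : EvalCtx

/-- `E[N]`. The hole is never in the scope of a binder of `E`. -/
def EvalCtx.fill : EvalCtx → Term → Term
  | .hole, N => N
  | .argOf E V _, N => E.fill (.app V N)
  | .funOf E M, N => E.fill (.app N M)
  | .letOf E M, N => E.fill (.letT M N)

/-- The `E₀`-rewriting relation. -/
inductive E0Step : Term → Term → Prop
  /-- `E[(μk.J)M] → E[(z M) z:=μk.J]` with `z` fresh -/
  | admin₁ (E : EvalCtx) (J : Jump) (M : Term) :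
      E0Step (E.fill (.app (.mu J) M)) (E.fill (.letT (.app (.var 0) M.shiftO) (.mu J)))
  /-- `E[V(μk.J)] → E[(V z) z:=μk.J]` with `z` fresh -/
  | admin₂ (E : EvalCtx) (V : Term) (J : Jump) (hV : V.isValue = true) :
      E0Step (E.fill (.app V (.mu J))) (E.fill (.letT (.app V.shiftO (.var 0)) (.mu J)))
  /-- `E[(λx.M)V] → E[M x:=V]` -/
  | betaLam (E : EvalCtx) (M V : Term) (hV : V.isValue = true) :
      E0Step (E.fill (.app (.lam M) V)) (E.fill (.letT M V))
  /-- `E[M x:=V] → E[M{V/x}]` -/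
  | betaLet (E : EvalCtx) (M V : Term) (hV : V.isValue = true) :
      E0Step (E.fill (.letT M V)) (E.fill (M.inst V))
  /-- `E[M x:=μk.J] → E[μk.J{[k]□ ↦ [k](M x:=□)}]` -/
  | betaMu (E : EvalCtx) (M : Term) (J : Jump) :
      E0Step (E.fill (.letT M (.mu J))) (E.fill (.mu (J.ctxSubst 0 M.shiftC)))

/-- The `E`-rewriting relation. -/
inductive EStep : Term → Term → Prop
  /-- `μk.[l]μm.J → μk.J{l/m}` -/
  | collapse (l : ℕ) (J : Jump) : EStep (.mu (.jmp l (.mu J))) (.mu (J.instC l))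
  | base {L M : Term} : E0Step L M → EStep L M
  | underMu (l : ℕ) {L M : Term} : E0Step L M → EStep (.mu (.jmp l L)) (.mu (.jmp l M))

/-- A term is `E`-normal if it admits no `E`-rewriting. -/
def ENormal (N : Term) : Prop := ∀ P, ¬ EStep N P

/-- The call-by-value evaluation from `M` terminates. -/
def EvalTerminates (M : Term) : Prop := ∃ N, ReflTransGen EStep M.read N ∧ ENormal N

/-! ## The untyped lambda calculus -/

/-- Untyped lambda-terms with de Bruijn indices. -/
inductive Lam : Type
  | var : ℕ → Lam
  | lam : Lam → Lam
  | app : Lam → Lam → Lam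

def Lam.rename : Lam → (ℕ → ℕ) → Lam
  | .var x, ξ => .var (ξ x)
  | .lam t, ξ => .lam (t.rename (upr ξ))
  | .app t u, ξ => .app (t.rename ξ) (u.rename ξ)

def Lam.shift (t : Lam) : Lam := t.rename Nat.succ

def Lam.ups (σ : ℕ → Lam) : ℕ → Lam
  | 0 => .var 0
  | n + 1 => (σ n).shift

def Lam.subst : Lam → (ℕ → Lam) → Lam
  | .var x, σ => σ x
  | .lam t, σ => .lam (t.subst (Lam.ups σ))
  | .app t u, σ => .app (t.subst σ) (u.subst σ)

/-- `t{u/x}` where `x` is the index `0` of `t`. -/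
def Lam.inst (t u : Lam) : Lam :=
  t.subst fun
    | 0 => u
    | n + 1 => .var n

/-- One-step beta-reduction. -/
inductive Lam.Beta : Lam → Lam → Prop
  | beta (t u : Lam) : Lam.Beta (.app (.lam t) u) (t.inst u)
  | lam {t t' : Lam} : Lam.Beta t t' → Lam.Beta (.lam t) (.lam t')
  | appL {t t' : Lam} (u : Lam) : Lam.Beta t t' → Lam.Beta (.app t u) (.app t' u)
  | appR (t : Lam) {u u' : Lam} : Lam.Beta u u' → Lam.Beta (.app t u) (.app t u')

/-- Beta-equality. -/
def Lam.BetaEq : Lam → Lam → Prop := EqvGen Lam.Beta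

/-- `t u₁ ⋯ uₘ` -/
def Lam.apps (t : Lam) (us : List Lam) : Lam := us.foldl .app t

/-- `λx₁ ⋯ xₙ. t` -/
def Lam.lams (n : ℕ) (t : Lam) : Lam := Lam.lam^[n] t

/-- All free indices of the term are smaller than `n`. -/
def Lam.FVBelow : Lam → ℕ → Prop
  | .var x, n => x < n
  | .lam t, n => t.FVBelow (n + 1)
  | .app t u, n => t.FVBelow n ∧ u.FVBelow n

/-- A term is solvable if some closure of it, applied to suitably chosen terms, is beta-equal to
the identity `λx. x`. -/
def Lam.Solvable (t : Lam) : Prop :=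
  ∃ n, t.FVBelow n ∧ ∃ us : List Lam, Lam.BetaEq (Lam.apps (Lam.lams n t) us) (.lam (.var 0))

/-- Head normal forms `λx₁ ⋯ xₙ. y u₁ ⋯ uₘ`. -/
def Lam.IsHNF (t : Lam) : Prop :=
  ∃ (n y : ℕ) (us : List Lam), t = Lam.lams n (Lam.apps (.var y) us)

/-- A term has a head normal form if it is beta-equal to one. -/
def Lam.HasHNF (t : Lam) : Prop := ∃ u, Lam.BetaEq t u ∧ u.IsHNF

/-! ## The CPS translation -/

/- The target has one index space, so that the translations carry two environments: `ρ` maps the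
ordinary variables of the source, and `κ` its continuation variables, to variables of the target.
Below a binder of the target that binds an ordinary variable of the source they become `upr ρ` and
`Nat.succ ∘ κ`; below one that binds a continuation variable, `Nat.succ ∘ ρ` and `upr κ`; below one
that binds a fresh variable, `Nat.succ ∘ ρ` and `Nat.succ ∘ κ`. -/
mutual
/-- The translation `⟨M⟩[K]`. For `V` a value and `N` a non-value,
* `⟨V⟩[K] = K V*`
* `⟨V₁ V₂⟩[K] = V₁* V₂* K`
* `⟨V N⟩[K] = ⟨N⟩[λy. V* y K]`
* `⟨N V⟩[K] = ⟨N⟩[λx. x V* K]`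
* `⟨N₁ N₂⟩[K] = ⟨N₁⟩[λx. ⟨N₂⟩[λy. x y K]]`
* `⟨L x:=M⟩[K] = ⟨M⟩[λx. ⟨L⟩[K]]`
* `⟨μk. J⟩[K] = (λk. ⟨J⟩) K` -/
def Term.colon : Term → (ℕ → ℕ) → (ℕ → ℕ) → Lam → Lam
  | .var x, ρ, _, K => .app K (.var (ρ x))
  | .lam M, ρ, κ, K =>
    .app K (.lam (.lam
      (M.colon (Nat.succ ∘ upr ρ) (Nat.succ ∘ Nat.succ ∘ κ) (.var 0))))
  | .app M N, ρ, κ, K =>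
    match M.isValue, N.isValue with
    | true, true => .app (.app (M.star ρ κ) (N.star ρ κ)) K
    | true, false =>
      N.colon ρ κ (.lam (.app (.app (M.star ρ κ).shift (.var 0)) K.shift))
    | false, true =>
      M.colon ρ κ (.lam (.app (.app (.var 0) (N.star ρ κ).shift) K.shift))
    | false, false =>
      M.colon ρ κ (.lam (N.colon (Nat.succ ∘ ρ) (Nat.succ ∘ κ)
        (.lam (.app (.app (.var 1) (.var 0)) K.shift.shift))))
  | .letT L M, ρ, κ, K =>
    M.colon ρ κ (.lam (L.colon (upr ρ) (Nat.succ ∘ κ) K.shift))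
  | .mu J, ρ, κ, K => .app (.lam (J.colon (Nat.succ ∘ ρ) (upr κ))) K
/-- The translation `V*` of values: `x* = x` and `(λx. M)* = λx k. ⟨M⟩[k]`. It is used for values
only; its result on other terms is irrelevant. -/
def Term.star : Term → (ℕ → ℕ) → (ℕ → ℕ) → Lam
  | .var x, ρ, _ => .var (ρ x)
  | .lam M, ρ, κ =>
    .lam (.lam (M.colon (Nat.succ ∘ upr ρ) (Nat.succ ∘ Nat.succ ∘ κ) (.var 0)))
  | _, _, _ => .var 0
/-- The translation `⟨J⟩`: `⟨[k]M⟩ = ⟨M⟩[k]` and `⟨J x:=M⟩ = ⟨M⟩[λx. ⟨J⟩]`. -/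
def Jump.colon : Jump → (ℕ → ℕ) → (ℕ → ℕ) → Lam
  | .jmp k M, ρ, κ => M.colon ρ κ (.var (κ k))
  | .letJ J M, ρ, κ => M.colon ρ κ (.lam (J.colon (upr ρ) (Nat.succ ∘ κ)))
end

/-- The CPS translation `⟦M⟧ = λk. ⟨M⟩[k]` with `k` fresh. The free variables `x` and `k` of `M`
become the distinct free variables `2 x` and `2 k + 1` of the target. -/
def Term.cps (M : Term) : Lam :=
  .lam (M.colon (fun x => (2 * x) + 1) (fun k => (2 * k + 1) + 1) (.var 0))

end CCV

-- The three conditions are linked in a cycle: evaluation terminates, hence the translation has a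
-- head normal form, hence it is solvable, hence evaluation terminates.
--
-- Bracketings of one term have β-equal translations, and each evaluation step preserves the
-- translation up to β. A term on which evaluation halts is, after at most one β-step, translated to
-- a variable applied to arguments (`ENormal.exists_neutral`). The first implication follows. The
-- second is the classical one: substitute for the head variable a term that discards its arguments
-- and returns the identity.
--
-- For the third, β-equality must yield termination of a particular strategy. The graph model does
-- this. Its interpretation is invariant under β (`den_beta`) and nonempty for the identity, hence
-- nonempty in some environment for every solvable term; a reducibility argument turns nonemptiness
-- into a bound on weak head reduction (`exists_wbound`). Finally, weak head reduction of the
-- translation controls evaluation of the source (`EStep.wbound`): each evaluation step either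
-- lowers the bound, or keeps it and lowers a syntactic measure, so evaluation terminates by
-- lexicographic induction.

namespace CCV

namespace Lam

/-! ### Substitution calculus of the lambda calculus -/

/-- The substitution that maps `0` to `u` and `n + 1` to `σ n`. -/
def scons (u : Lam) (σ : ℕ → Lam) : ℕ → Lam
  | 0 => u
  | n + 1 => σ n

/-- Weakening of an environment by one fresh variable. -/
def wk (ρ : ℕ → Lam) : ℕ → Lam := fun n => (ρ n).shift

@[simp] theorem scons_zero (u : Lam) (σ : ℕ → Lam) : scons u σ 0 = u := rfl
@[simp] theorem scons_succ (u : Lam) (σ : ℕ → Lam) (n : ℕ) : scons u σ (n + 1) = σ n := rfl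
@[simp] theorem ups_zero (σ : ℕ → Lam) : ups σ 0 = .var 0 := rfl
@[simp] theorem ups_succ (σ : ℕ → Lam) (n : ℕ) : ups σ (n + 1) = (σ n).shift := rfl

theorem inst_eq (t u : Lam) : t.inst u = t.subst (scons u .var) := by
  unfold inst
  congr 1

theorem ups_var_comp (ξ : ℕ → ℕ) : ups (fun n => .var (ξ n)) = fun n => .var (upr ξ n) := by
  funext n
  cases n <;> rfl

theorem ups_var : ups .var = .var := by
  funext n
  cases n <;> rfl

theorem ups_comp_upr (σ : ℕ → Lam) (ξ : ℕ → ℕ) :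
    (fun n => ups σ (upr ξ n)) = ups (fun n => σ (ξ n)) := by
  funext n
  cases n <;> rfl

@[simp] theorem subst_var (t : Lam) : t.subst .var = t := by
  induction t with
  | var => rfl
  | lam t ih => simp [subst, ups_var, ih]
  | app t u iht ihu => simp [subst, iht, ihu]

theorem rename_eq_subst (t : Lam) (ξ : ℕ → ℕ) : t.rename ξ = t.subst fun n => .var (ξ n) := by
  induction t generalizing ξ with
  | var => rfl
  | lam t ih => simp [subst, rename, ih, ups_var_comp]
  | app t u iht ihu => simp [subst, rename, iht, ihu]

theorem rename_subst (t : Lam) (ξ : ℕ → ℕ) (σ : ℕ → Lam) :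
    (t.rename ξ).subst σ = t.subst fun n => σ (ξ n) := by
  induction t generalizing ξ σ with
  | var => rfl
  | lam t ih => simp [subst, rename, ih, ups_comp_upr]
  | app t u iht ihu => simp [subst, rename, iht, ihu]

@[simp] theorem shift_subst_scons (t u : Lam) (σ : ℕ → Lam) :
    t.shift.subst (scons u σ) = t.subst σ :=
  rename_subst t _ _

theorem rename_rename (t : Lam) (ξ ζ : ℕ → ℕ) :
    (t.rename ξ).rename ζ = t.rename fun n => ζ (ξ n) := by
  simp only [rename_eq_subst _ ζ, rename_subst]
  rw [rename_eq_subst]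

theorem subst_rename (t : Lam) (σ : ℕ → Lam) (ξ : ℕ → ℕ) :
    (t.subst σ).rename ξ = t.subst fun n => (σ n).rename ξ := by
  induction t generalizing ξ σ with
  | var => rfl
  | lam t ih =>
    simp only [subst, rename, ih, lam.injEq]
    congr 1
    funext n
    cases n with
    | zero => rfl
    | succ n =>
      simp only [ups_succ, shift, rename_rename]
      rfl
  | app t u iht ihu => simp [subst, rename, iht, ihu]

@[simp] theorem shift_subst_ups (t : Lam) (σ : ℕ → Lam) :
    t.shift.subst (ups σ) = (t.subst σ).shift := by
  simp only [shift, rename_subst, subst_rename, ups_succ]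

theorem subst_subst (t : Lam) (σ τ : ℕ → Lam) :
    (t.subst σ).subst τ = t.subst fun n => (σ n).subst τ := by
  induction t generalizing σ τ with
  | var => rfl
  | lam t ih =>
    simp only [subst, ih, lam.injEq]
    congr 1
    funext n
    cases n <;> simp [subst]
  | app t u iht ihu => simp [subst, iht, ihu]

theorem ups_subst_ups (ρ σ : ℕ → Lam) :
    (fun n => (ups ρ n).subst (ups σ)) = ups fun n => (ρ n).subst σ := by
  funext n
  cases n <;> simp [subst]

theorem ups_subst_scons (ρ σ : ℕ → Lam) (u : Lam) :
    (fun n => (ups ρ n).subst (scons u σ)) = scons u fun n => (ρ n).subst σ := by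
  funext n
  cases n <;> simp [subst]

/-! ### Beta-equality -/

namespace BetaEq

theorem refl (t : Lam) : BetaEq t t := EqvGen.refl t

theorem symm {t u : Lam} (h : BetaEq t u) : BetaEq u t := EqvGen.symm _ _ h

theorem trans {t u v : Lam} (h : BetaEq t u) (h' : BetaEq u v) : BetaEq t v :=
  EqvGen.trans _ _ _ h h'

theorem of_eq {t u : Lam} (h : t = u) : BetaEq t u := h ▸ refl t

theorem map {f : Lam → Lam} (hf : ∀ t u, Beta t u → Beta (f t) (f u)) {t u : Lam}
    (h : BetaEq t u) : BetaEq (f t) (f u) := by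
  induction h with
  | rel _ _ h => exact EqvGen.rel _ _ (hf _ _ h)
  | refl => exact refl _
  | symm _ _ _ ih => exact ih.symm
  | trans _ _ _ _ _ ih ih' => exact ih.trans ih'

theorem lam {t u : Lam} (h : BetaEq t u) : BetaEq (.lam t) (.lam u) :=
  map (fun _ _ => Beta.lam) h

theorem app {t t' u u' : Lam} (h : BetaEq t t') (h' : BetaEq u u') :
    BetaEq (.app t u) (.app t' u') :=
  (map (f := fun s => .app s u) (fun _ _ => Beta.appL u) h).trans
    (map (f := fun s => .app t' s) (fun _ _ => Beta.appR t') h')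

theorem beta (t u : Lam) : BetaEq (.app (.lam t) u) (t.subst (scons u .var)) := by
  rw [← inst_eq]
  exact EqvGen.rel _ _ (Beta.beta t u)

theorem lams {t u : Lam} (n : ℕ) (h : BetaEq t u) : BetaEq (lams n t) (lams n u) := by
  induction n with
  | zero => exact h
  | succ n ih =>
    simp only [Lam.lams, Function.iterate_succ'] at ih ⊢
    exact ih.lam

theorem apps {t u : Lam} (us : List Lam) (h : BetaEq t u) : BetaEq (apps t us) (apps u us) := by
  induction us generalizing t u with
  | nil => exact h
  | cons v us ih => exact ih (h.app (refl v))

theorem subst {t u : Lam} (h : BetaEq t u) (σ : ℕ → Lam) : BetaEq (t.subst σ) (u.subst σ) := by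
  induction h with
  | rel t u h =>
    induction h generalizing σ with
    | beta t u =>
      simp only [Lam.subst, inst_eq, subst_subst]
      refine (beta _ _).trans (of_eq ?_)
      rw [subst_subst]
      congr 1
      funext n
      cases n <;> simp [Lam.subst]
    | lam _ ih => exact (ih _).lam
    | appL _ _ ih => exact (ih _).app (refl _)
    | appR _ _ ih => exact (refl _).app (ih _)
  | refl => exact refl _
  | symm _ _ _ ih => exact ih.symm
  | trans _ _ _ _ _ ih ih' => exact ih.trans ih'

theorem shift {t u : Lam} (h : BetaEq t u) : BetaEq t.shift u.shift := by
  simp only [Lam.shift, rename_eq_subst]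
  exact h.subst _

end BetaEq

/-! ### Weak head reduction -/

/-- Weak head reduction. -/
inductive WStep : Lam → Lam → Prop
  | beta (t u : Lam) : WStep (.app (.lam t) u) (t.subst (scons u .var))
  | app {t t' : Lam} (u : Lam) : WStep t t' → WStep (.app t u) (.app t' u)

theorem WStep.betaEq {t u : Lam} (h : WStep t u) : BetaEq t u := by
  induction h with
  | beta t u => exact BetaEq.beta t u
  | app u _ ih => exact ih.app (BetaEq.refl u)

theorem WStep.deterministic {t u v : Lam} (h : WStep t u) (h' : WStep t v) : u = v := by
  induction h generalizing v with
  | beta => cases h' with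
    | beta => rfl
    | app _ h => cases h
  | app _ h ih => cases h' with
    | beta => cases h
    | app _ h' => rw [ih h']

/-- All weak head reductions from a term have at most `n` steps. -/
def WBound : ℕ → Lam → Prop
  | 0, t => ∀ t', ¬ WStep t t'
  | n + 1, t => ∀ t', WStep t t' → WBound n t'

theorem WBound.succ {n : ℕ} {t : Lam} (h : WBound n t) : WBound (n + 1) t := by
  induction n generalizing t with
  | zero => exact fun t' ht => (h t' ht).elim
  | succ n ih => exact fun t' ht => ih (h t' ht)

theorem WBound.step {n : ℕ} {t u : Lam} (h : WBound n t) (htu : WStep t u) :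
    ∃ m, n = m + 1 ∧ WBound m u := by
  cases n with
  | zero => exact (h _ htu).elim
  | succ n => exact ⟨n, rfl, h _ htu⟩

theorem WBound.of_step {n : ℕ} {t u : Lam} (h : WBound n u) (htu : WStep t u) :
    WBound (n + 1) t :=
  fun _ ht => ht.deterministic htu ▸ h

theorem WBound.steps {n : ℕ} {t u : Lam} (h : WBound n t) (htu : ReflTransGen WStep t u) :
    ∃ m ≤ n, WBound m u := by
  induction htu with
  | refl => exact ⟨n, le_rfl, h⟩
  | tail _ h' ih =>
    obtain ⟨m, hm, h⟩ := ih
    obtain ⟨k, rfl, h''⟩ := h.step h'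
    exact ⟨k, by omega, h''⟩

/-- Every weak head step of the function part is also a step of the application. -/
theorem WBound.of_app {n : ℕ} {t u : Lam} (h : WBound n (.app t u)) : WBound n t := by
  induction n generalizing t with
  | zero => exact fun t' ht => h _ (ht.app u)
  | succ n ih => exact fun t' ht => ih (h _ (ht.app u))

/-! ### The graph model -/

/-- The elements of the graph model: intersection types. -/
inductive Ty : Type
  | base : Ty
  | arr : List Ty → Ty → Ty

/-- The extension of an environment of the graph model. -/
def dcons (X : Set Ty) (Γ : ℕ → Set Ty) : ℕ → Set Ty
  | 0 => X
  | n + 1 => Γ n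

/-- The interpretation of a term in the graph model: the set of its types. -/
def den : Lam → (ℕ → Set Ty) → Set Ty
  | .var x, Γ => Γ x
  | .lam t, Γ => {C | ∃ S A, C = .arr S A ∧ A ∈ t.den (dcons {B | B ∈ S} Γ)}
  | .app t u, Γ => {A | ∃ S, .arr S A ∈ t.den Γ ∧ ∀ B ∈ S, B ∈ u.den Γ}

theorem den_rename (t : Lam) (ξ : ℕ → ℕ) (Γ : ℕ → Set Ty) :
    (t.rename ξ).den Γ = t.den fun n => Γ (ξ n) := by
  induction t generalizing ξ Γ with
  | var => rfl
  | lam t ih =>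
    have (S : List Ty) : (fun n => dcons {B | B ∈ S} Γ (upr ξ n)) =
        dcons {B | B ∈ S} fun n => Γ (ξ n) := by
      funext n
      cases n <;> rfl
    simp only [rename, den, ih, this]
  | app t u iht ihu => simp only [rename, den, iht, ihu]

theorem den_subst (t : Lam) (σ : ℕ → Lam) (Γ : ℕ → Set Ty) :
    (t.subst σ).den Γ = t.den fun n => (σ n).den Γ := by
  induction t generalizing σ Γ with
  | var => rfl
  | lam t ih =>
    have (S : List Ty) : (fun n => (ups σ n).den (dcons {B | B ∈ S} Γ)) =
        dcons {B | B ∈ S} fun n => (σ n).den Γ := by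
      funext n
      cases n with
      | zero => rfl
      | succ n => exact den_rename _ _ _
    simp only [subst, den, ih, this]
  | app t u iht ihu => simp only [subst, den, iht, ihu]

theorem dcons_mono {X Y : Set Ty} {Γ Δ : ℕ → Set Ty} (hX : X ⊆ Y) (h : ∀ n, Γ n ⊆ Δ n) (n : ℕ) :
    dcons X Γ n ⊆ dcons Y Δ n := by
  cases n with
  | zero => exact hX
  | succ n => exact h n

theorem den_mono (t : Lam) {Γ Δ : ℕ → Set Ty} (h : ∀ n, Γ n ⊆ Δ n) : t.den Γ ⊆ t.den Δ := by
  induction t generalizing Γ Δ with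
  | var x => exact h x
  | lam t ih =>
    rintro _ ⟨S, A, rfl, hA⟩
    exact ⟨S, A, rfl, ih (dcons_mono subset_rfl h) hA⟩
  | app t u iht ihu =>
    rintro A ⟨S, hS, hB⟩
    exact ⟨S, iht h hS, fun B hB' => ihu h (hB B hB')⟩

/-- Continuity of the model: a typing derivation uses only finitely many assumptions on each
variable. β-expansion needs this, since the source of an arrow is a finite list. -/
theorem den_finite (t : Lam) {Γ : ℕ → Set Ty} {A : Ty} (h : A ∈ t.den Γ) :
    ∃ F : ℕ → List Ty, (∀ n, ∀ B ∈ F n, B ∈ Γ n) ∧ A ∈ t.den fun n => {B | B ∈ F n} := by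
  induction t generalizing Γ A with
  | var x =>
    classical
    refine ⟨fun n => if n = x then [A] else [], fun n B hB => ?_, by simp [den]⟩
    dsimp only at hB
    split_ifs at hB with hn
    · rw [List.mem_singleton.mp hB, hn]
      exact h
    · simp at hB
  | lam t ih =>
    obtain ⟨S, A, rfl, hA⟩ := h
    obtain ⟨F, hF, hA⟩ := ih hA
    refine ⟨fun n => F (n + 1), fun n => hF (n + 1), S, A, rfl, den_mono t ?_ hA⟩
    intro n
    cases n with
    | zero => exact hF 0
    | succ n => exact subset_rfl
  | app t u iht ihu =>
    obtain ⟨S, hS, hu⟩ := h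
    obtain ⟨F, hF, hS'⟩ := iht hS
    -- The argument is typed once for each element of the finite list `S`; concatenating the
    -- assumptions of these derivations keeps them finite.
    have key : ∀ S : List Ty, (∀ B ∈ S, B ∈ u.den Γ) → ∃ G : ℕ → List Ty,
        (∀ n, ∀ B ∈ G n, B ∈ Γ n) ∧ ∀ B ∈ S, B ∈ u.den fun n => {C | C ∈ G n} := by
      intro S
      induction S with
      | nil => exact fun _ => ⟨fun _ => [], by simp, by simp⟩
      | cons C S ih =>
        intro h
        obtain ⟨G, hG, hB⟩ := ih fun B hB => h B (List.mem_cons_of_mem _ hB)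
        obtain ⟨H, hH, hC⟩ := ihu (h C List.mem_cons_self)
        refine ⟨fun n => G n ++ H n, fun n B hB => ?_, fun B hB' => ?_⟩
        · exact (List.mem_append.mp hB).elim (hG n B) (hH n B)
        · rcases List.mem_cons.mp hB' with rfl | hB'
          · exact den_mono u (fun n D hD => List.mem_append_right _ hD) hC
          · exact den_mono u (fun n D hD => List.mem_append_left _ hD) (hB B hB')
    obtain ⟨G, hG, hB⟩ := key S hu
    refine ⟨fun n => F n ++ G n, fun n B hB => ?_, S, ?_, fun B hB' => ?_⟩
    · exact (List.mem_append.mp hB).elim (hF n B) (hG n B)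
    · exact den_mono t (fun n D hD => List.mem_append_left _ hD) hS'
    · exact den_mono u (fun n D hD => List.mem_append_right _ hD) (hB B hB')

theorem den_beta (t u : Lam) (Γ : ℕ → Set Ty) :
    (Lam.app (.lam t) u).den Γ = (t.inst u).den Γ := by
  have henv : (fun n => (scons u .var n).den Γ) = dcons (u.den Γ) Γ := by
    funext n
    cases n <;> rfl
  rw [inst_eq, den_subst, henv]
  ext A
  constructor
  · rintro ⟨S, ⟨_, _, h, hA⟩, hu⟩
    cases h
    exact den_mono t (dcons_mono hu fun _ => subset_rfl) hA
  · intro h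
    obtain ⟨F, hF, hA⟩ := den_finite t h
    -- The finitely many types of `u` that the derivation uses for the bound variable become the
    -- source of the arrow.
    refine ⟨F 0, ⟨F 0, A, rfl, den_mono t ?_ hA⟩, hF 0⟩
    intro n
    cases n with
    | zero => exact subset_rfl
    | succ n => exact hF (n + 1)

theorem BetaEq.den_eq {t u : Lam} (h : BetaEq t u) : t.den = u.den := by
  induction h with
  | rel t u h =>
    induction h with
    | beta t u => exact funext (den_beta t u)
    | lam _ ih => simp only [den, ih]
    | appL _ _ ih => simp only [den, ih]
    | appR _ _ ih => simp only [den, ih]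
  | refl => rfl
  | symm _ _ _ ih => exact ih.symm
  | trans _ _ _ _ _ ih ih' => exact ih.trans ih'

theorem nonempty_den_of_apps {t : Lam} {us : List Lam} {Γ : ℕ → Set Ty}
    (h : ((apps t us).den Γ).Nonempty) : (t.den Γ).Nonempty := by
  induction us generalizing t with
  | nil => exact h
  | cons u us ih =>
    obtain ⟨A, S, hA, -⟩ := ih h
    exact ⟨_, hA⟩

theorem nonempty_den_of_lams {t : Lam} {n : ℕ} {Γ : ℕ → Set Ty}
    (h : ((lams n t).den Γ).Nonempty) : ∃ Δ, (t.den Δ).Nonempty := by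
  induction n generalizing Γ with
  | zero => exact ⟨Γ, h⟩
  | succ n ih =>
    simp only [lams, Function.iterate_succ'] at h
    obtain ⟨_, S, A, -, hA⟩ := h
    exact ih ⟨A, hA⟩

/-- The identity has a type, and typability passes backwards through β-equality, then from an
application to its head, and from an abstraction to its body in an extended environment. -/
theorem Solvable.nonempty_den {t : Lam} (h : t.Solvable) : ∃ Γ, (t.den Γ).Nonempty := by
  obtain ⟨n, -, us, h⟩ := h
  have hI : ((Lam.lam (.var 0)).den fun _ => ∅).Nonempty :=
    ⟨.arr [.base] .base, [.base], .base, rfl, List.mem_singleton_self _⟩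
  rw [← h.den_eq] at hI
  exact nonempty_den_of_lams (nonempty_den_of_apps hI)

/-! ### Reducibility -/

/-- The reducible terms of a type. -/
def Red : Ty → Lam → Prop
  | .base, t => ∃ n, WBound n t
  | .arr S A, t => ∀ u, (∀ B, B ∈ S → Red B u) → Red A (.app t u)
termination_by A => sizeOf A

/-- Variables applied to arguments. -/
inductive Neutral : Lam → Prop
  | var (x : ℕ) : Neutral (.var x)
  | app {t : Lam} (u : Lam) : Neutral t → Neutral (.app t u)

theorem Neutral.not_wstep {t u : Lam} (h : Neutral t) : ¬ WStep t u := by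
  induction h generalizing u with
  | var => exact fun h => nomatch h
  | app _ hn ih =>
    rintro (_ | ⟨_, h⟩)
    · exact nomatch hn
    · exact ih h

theorem Neutral.eq_apps {t : Lam} (h : Neutral t) : ∃ y us, t = apps (.var y) us := by
  induction h with
  | var x => exact ⟨x, [], rfl⟩
  | app u _ ih =>
    obtain ⟨y, us, rfl⟩ := ih
    exact ⟨y, us ++ [u], by simp [apps]⟩

theorem Neutral.red {t : Lam} (h : Neutral t) (A : Ty) : Red A t := by
  match A with
  | .base =>
    rw [Red]
    exact ⟨0, fun _ => h.not_wstep⟩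
  | .arr S A =>
    rw [Red]
    exact fun u _ => (h.app u).red A

/-- At the base type this rests on determinism: a bound for the only reduct gives a bound for the
term. Arrows reduce to this because weak head steps act on the function side. -/
theorem Red.of_wstep {A : Ty} {t u : Lam} (htu : WStep t u) (h : Red A u) : Red A t := by
  match A with
  | .base =>
    rw [Red] at h ⊢
    obtain ⟨n, h⟩ := h
    exact ⟨n + 1, h.of_step htu⟩
  | .arr S A =>
    rw [Red] at h ⊢
    exact fun v hv => (h v hv).of_wstep (htu.app v)

/-- A variable is reducible at every type, so it can serve as an argument; a bound for the
application then bounds its function part. -/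
theorem Red.bounded {A : Ty} {t : Lam} (h : Red A t) : ∃ n, WBound n t := by
  match A with
  | .base => rwa [Red] at h
  | .arr S A =>
    rw [Red] at h
    obtain ⟨n, hn⟩ := (h (.var 0) fun B _ => (Neutral.var 0).red B).bounded
    exact ⟨n, hn.of_app⟩

/-- The fundamental lemma of the reducibility method; abstractions use closure under weak head
expansion. -/
theorem red_subst (t : Lam) {Γ : ℕ → Set Ty} {A : Ty} (hA : A ∈ t.den Γ) (σ : ℕ → Lam)
    (hσ : ∀ n, ∀ B ∈ Γ n, Red B (σ n)) : Red A (t.subst σ) := by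
  induction t generalizing Γ A σ with
  | var x => exact hσ x A hA
  | lam t ih =>
    obtain ⟨S, A, rfl, hA⟩ := hA
    rw [Red]
    refine fun u hu => Red.of_wstep (WStep.beta _ _) ?_
    rw [subst_subst, ups_subst_scons]
    refine ih hA _ fun n => ?_
    cases n with
    | zero => exact hu
    | succ n =>
      simp only [scons_succ, subst_var]
      exact hσ n
  | app t u iht ihu =>
    obtain ⟨S, hS, hu⟩ := hA
    have := iht hS σ hσ
    rw [Red] at this
    exact this _ fun B hB => ihu (hu B hB) σ hσ

theorem exists_wbound {t : Lam} {Γ : ℕ → Set Ty} (h : (t.den Γ).Nonempty) : ∃ n, WBound n t := by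
  obtain ⟨A, hA⟩ := h
  have := red_subst t hA .var fun n B _ => (Neutral.var n).red B
  rw [subst_var] at this
  exact this.bounded

/-! ### Head normal forms are solvable -/

theorem FVBelow.mono {t : Lam} {m n : ℕ} (h : t.FVBelow m) (hmn : m ≤ n) : t.FVBelow n := by
  induction t generalizing m n with
  | var x => exact lt_of_lt_of_le h hmn
  | lam t ih => exact ih (m := m + 1) h (by omega)
  | app t u iht ihu => exact ⟨iht h.1 hmn, ihu h.2 hmn⟩

theorem exists_fvBelow (t : Lam) : ∃ n, t.FVBelow n := by
  induction t with
  | var x => exact ⟨x + 1, Nat.lt_succ_self x⟩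
  | lam t ih =>
    obtain ⟨n, h⟩ := ih
    exact ⟨n, h.mono (Nat.le_succ n)⟩
  | app t u iht ihu =>
    obtain ⟨m, hm⟩ := iht
    obtain ⟨n, hn⟩ := ihu
    exact ⟨max m n, hm.mono (le_max_left _ _), hn.mono (le_max_right _ _)⟩

theorem lams_succ (n : ℕ) (t : Lam) : lams (n + 1) t = .lam (lams n t) := by
  simp only [lams, Function.iterate_succ', Function.comp_apply]

theorem lams_lams (m n : ℕ) (t : Lam) : lams m (lams n t) = lams (m + n) t := by
  simp only [lams, Function.iterate_add, Function.comp_apply]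

theorem apps_subst (t : Lam) (us : List Lam) (σ : ℕ → Lam) :
    (apps t us).subst σ = apps (t.subst σ) (us.map (subst · σ)) := by
  induction us generalizing t with
  | nil => rfl
  | cons u us ih => exact ih (.app t u)

/-- Each argument is discarded by one abstraction. The arbitrary `σ` spares a proof that the
abstracted identity is closed. -/
theorem betaEq_apps_lams_identity (us : List Lam) (σ : ℕ → Lam) :
    BetaEq (apps ((lams us.length (.lam (.var 0))).subst σ) us) (.lam (.var 0)) := by
  induction us generalizing σ with
  | nil => exact BetaEq.refl _
  | cons u us ih =>
    refine BetaEq.trans (BetaEq.apps us ?_) (ih fun n => (ups σ n).subst (scons u .var))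
    rw [List.length_cons, lams_succ, ← subst_subst]
    exact BetaEq.beta _ _

/-- The number `a` counts the variables already replaced by `P`; it grows by one with each
contracted abstraction. -/
theorem betaEq_apps_lams_replicate (P s : Lam) (n a : ℕ) (τ : ℕ → Lam) (hτ : ∀ x < a, τ x = P) :
    ∃ τ' : ℕ → Lam, (∀ x < n + a, τ' x = P) ∧
      BetaEq (apps ((lams n s).subst τ) (List.replicate n P)) (s.subst τ') := by
  induction n generalizing a τ with
  | zero => exact ⟨τ, by simpa using hτ, BetaEq.refl _⟩
  | succ n ih =>
    obtain ⟨τ', hτ', h⟩ := ih (a + 1) (scons P τ) fun x hx => by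
      cases x with
      | zero => rfl
      | succ x => exact hτ x (by omega)
    refine ⟨τ', fun x hx => hτ' x (by omega), BetaEq.trans ?_ h⟩
    rw [lams_succ, List.replicate_succ]
    refine BetaEq.apps _ ((BetaEq.beta _ _).trans (BetaEq.of_eq ?_))
    rw [subst_subst, ups_subst_scons]
    simp only [subst_var]

theorem HasHNF.solvable {t : Lam} (h : t.HasHNF) : t.Solvable := by
  obtain ⟨_, h, k, y, us, rfl⟩ := h
  obtain ⟨m, hm⟩ := exists_fvBelow t
  -- The closure also covers `y + 1`, so that the head variable is certainly among those replaced by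
  -- `P`.
  set n := max m (y + 1) with hn
  set P := lams us.length (.lam (.var 0)) with hP
  obtain ⟨τ, hτ, h'⟩ := betaEq_apps_lams_replicate P (apps (.var y) us) (n + k) 0 .var (by simp)
  refine ⟨n, hm.mono (le_max_left _ _), List.replicate (n + k) P, ?_⟩
  have hy : τ y = P := hτ y (by omega)
  rw [subst_var] at h'
  refine (BetaEq.apps _ ((h.lams n).trans (BetaEq.of_eq (lams_lams n k _)))).trans (h'.trans ?_)
  rw [apps_subst, subst, hy, hP, ← List.length_map (f := (subst · τ)), ← subst_var (lams _ _)]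
  exact betaEq_apps_lams_identity _ _

end Lam

end CCV

namespace CCV

open Lam (scons wk WStep)

/-! ### The CPS translation with terms as environments -/

mutual
/-- The translation `⟨M⟩[K]` in which variables are replaced by arbitrary terms. -/
def Term.cpsE : Term → (ℕ → Lam) → (ℕ → Lam) → Lam → Lam
  | .var x, ρ, _, K => .app K (ρ x)
  | .lam M, ρ, κ, K =>
    .app K (.lam (.lam (M.cpsE (wk (Lam.ups ρ)) (wk (wk κ)) (.var 0))))
  | .app M N, ρ, κ, K =>
    match M.isValue, N.isValue with
    | true, true => .app (.app (M.starE ρ κ) (N.starE ρ κ)) K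
    | true, false =>
      N.cpsE ρ κ (.lam (.app (.app (M.starE ρ κ).shift (.var 0)) K.shift))
    | false, true =>
      M.cpsE ρ κ (.lam (.app (.app (.var 0) (N.starE ρ κ).shift) K.shift))
    | false, false =>
      M.cpsE ρ κ (.lam (N.cpsE (wk ρ) (wk κ)
        (.lam (.app (.app (.var 1) (.var 0)) K.shift.shift))))
  | .letT L M, ρ, κ, K => M.cpsE ρ κ (.lam (L.cpsE (Lam.ups ρ) (wk κ) K.shift))
  | .mu J, ρ, κ, K => .app (.lam (J.cpsE (wk ρ) (Lam.ups κ))) K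
/-- The translation `V*` of values in which variables are replaced by arbitrary terms. -/
def Term.starE : Term → (ℕ → Lam) → (ℕ → Lam) → Lam
  | .var x, ρ, _ => ρ x
  | .lam M, ρ, κ => .lam (.lam (M.cpsE (wk (Lam.ups ρ)) (wk (wk κ)) (.var 0)))
  | _, _, _ => .var 0
/-- The translation `⟨J⟩` in which variables are replaced by arbitrary terms. -/
def Jump.cpsE : Jump → (ℕ → Lam) → (ℕ → Lam) → Lam
  | .jmp k M, ρ, κ => M.cpsE ρ κ (κ k)
  | .letJ J M, ρ, κ => M.cpsE ρ κ (.lam (J.cpsE (Lam.ups ρ) (wk κ)))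
end

/-- The continuation `λx. ⟨M⟩[c]`. -/
def Term.frame (M : Term) (ρ κ : ℕ → Lam) (c : Lam) : Lam :=
  .lam (M.cpsE (Lam.ups ρ) (wk κ) c.shift)

theorem Term.cpsE_value {V : Term} (hV : V.isValue = true) (ρ κ : ℕ → Lam) (K : Lam) :
    V.cpsE ρ κ K = .app K (V.starE ρ κ) := by
  cases V <;> first | rfl | simp [Term.isValue] at hV

theorem wk_var_comp (f : ℕ → ℕ) :
    wk (fun n => .var (f n)) = fun n => .var ((Nat.succ ∘ f) n) := rfl

mutual
-- Terms as environments are what turns substitution of values and of contexts in the source into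
-- mere changes of environment.
theorem Term.colon_eq_cpsE (M : Term) (ρ κ : ℕ → ℕ) (K : Lam) :
    M.colon ρ κ K = M.cpsE (fun n => .var (ρ n)) (fun n => .var (κ n)) K := by
  match M with
  | .var x => rfl
  | .lam M =>
    simp only [Term.colon, Term.cpsE, Term.colon_eq_cpsE M, wk_var_comp, Lam.ups_var_comp]
  | .app M N =>
    have hM := Term.star_eq_starE M ρ κ
    have hN := Term.star_eq_starE N ρ κ
    simp only [Term.colon, Term.cpsE, Term.colon_eq_cpsE M, Term.colon_eq_cpsE N, hM, hN,
      wk_var_comp]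
  | .letT L M =>
    simp only [Term.colon, Term.cpsE, Term.colon_eq_cpsE M, Term.colon_eq_cpsE L, wk_var_comp,
      Lam.ups_var_comp]
  | .mu J =>
    simp only [Term.colon, Term.cpsE, Jump.colon_eq_cpsE J, wk_var_comp, Lam.ups_var_comp]
theorem Term.star_eq_starE (M : Term) (ρ κ : ℕ → ℕ) :
    M.star ρ κ = M.starE (fun n => .var (ρ n)) (fun n => .var (κ n)) := by
  match M with
  | .var x => rfl
  | .lam M =>
    simp only [Term.star, Term.starE, Term.colon_eq_cpsE M, wk_var_comp, Lam.ups_var_comp]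
  | .app M N => rfl
  | .letT L M => rfl
  | .mu J => rfl
theorem Jump.colon_eq_cpsE (J : Jump) (ρ κ : ℕ → ℕ) :
    J.colon ρ κ = J.cpsE (fun n => .var (ρ n)) (fun n => .var (κ n)) := by
  match J with
  | .jmp k M => simp only [Jump.colon, Jump.cpsE, Term.colon_eq_cpsE M]
  | .letJ J M =>
    simp only [Jump.colon, Jump.cpsE, Term.colon_eq_cpsE M, Jump.colon_eq_cpsE J, wk_var_comp,
      Lam.ups_var_comp]
end

/-! ### Substitution in the target -/

theorem wk_subst_ups (ρ σ : ℕ → Lam) :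
    (fun n => (wk ρ n).subst (Lam.ups σ)) = wk fun n => (ρ n).subst σ := by
  funext n
  exact Lam.shift_subst_ups _ _

theorem wk_subst_scons (ρ σ : ℕ → Lam) (u : Lam) :
    (fun n => (wk ρ n).subst (scons u σ)) = fun n => (ρ n).subst σ := by
  funext n
  exact Lam.shift_subst_scons _ _ _

mutual
theorem Term.cpsE_subst (M : Term) (ρ κ : ℕ → Lam) (K : Lam) (σ : ℕ → Lam) :
    (M.cpsE ρ κ K).subst σ =
      M.cpsE (fun n => (ρ n).subst σ) (fun n => (κ n).subst σ) (K.subst σ) := by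
  match M with
  | .var x => rfl
  | .lam M =>
    simp only [Term.cpsE, Lam.subst, Term.cpsE_subst M, wk_subst_ups, Lam.ups_subst_ups,
      Lam.ups_zero]
  | .app M N =>
    have hM := Term.starE_subst M
    have hN := Term.starE_subst N
    rcases hm : M.isValue <;> rcases hn : N.isValue <;>
      simp only [Term.cpsE, Lam.subst, Term.cpsE_subst M, Term.cpsE_subst N, hm, hn, hM, hN,
        wk_subst_ups, Lam.ups_zero, Lam.ups_succ, Lam.shift_subst_ups]
    all_goals rfl
  | .letT L M =>
    simp only [Term.cpsE, Lam.subst, Term.cpsE_subst M, Term.cpsE_subst L, wk_subst_ups,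
      Lam.ups_subst_ups, Lam.shift_subst_ups]
  | .mu J =>
    simp only [Term.cpsE, Lam.subst, Jump.cpsE_subst J, wk_subst_ups, Lam.ups_subst_ups]
-- Restricted to values, because the default `.var 0` on other terms is not stable under
-- substitution.
theorem Term.starE_subst (M : Term) (hM : M.isValue = true) (ρ κ : ℕ → Lam) (σ : ℕ → Lam) :
    (M.starE ρ κ).subst σ = M.starE (fun n => (ρ n).subst σ) (fun n => (κ n).subst σ) := by
  match M with
  | .var x => rfl
  | .lam M =>
    simp only [Term.starE, Lam.subst, Term.cpsE_subst M, wk_subst_ups, Lam.ups_subst_ups,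
      Lam.ups_zero]
theorem Jump.cpsE_subst (J : Jump) (ρ κ : ℕ → Lam) (σ : ℕ → Lam) :
    (J.cpsE ρ κ).subst σ = J.cpsE (fun n => (ρ n).subst σ) fun n => (κ n).subst σ := by
  match J with
  | .jmp k M => simp only [Jump.cpsE, Term.cpsE_subst M]
  | .letJ J M =>
    simp only [Jump.cpsE, Lam.subst, Term.cpsE_subst M, Jump.cpsE_subst J, wk_subst_ups,
      Lam.ups_subst_ups]
end

theorem Term.frame_subst (M : Term) (ρ κ : ℕ → Lam) (c : Lam) (σ : ℕ → Lam) :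
    (M.frame ρ κ c).subst σ =
      M.frame (fun n => (ρ n).subst σ) (fun n => (κ n).subst σ) (c.subst σ) := by
  simp only [Term.frame, Lam.subst, Term.cpsE_subst, wk_subst_ups, Lam.ups_subst_ups,
    Lam.shift_subst_ups]

theorem Lam.shift_eq_subst (t : Lam) : t.shift = t.subst fun n => .var (n + 1) :=
  Lam.rename_eq_subst t _

theorem wk_eq_subst (ρ : ℕ → Lam) : wk ρ = fun n => (ρ n).subst fun n => .var (n + 1) :=
  funext fun n => Lam.shift_eq_subst (ρ n)

theorem Term.starE_shift {M : Term} (hM : M.isValue = true) (ρ κ : ℕ → Lam) :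
    (M.starE ρ κ).shift = M.starE (wk ρ) (wk κ) := by
  simp only [wk_eq_subst, Lam.shift_eq_subst, Term.starE_subst M hM]

theorem Term.frame_shift (M : Term) (ρ κ : ℕ → Lam) (c : Lam) :
    (M.frame ρ κ c).shift = M.frame (wk ρ) (wk κ) c.shift := by
  simp only [wk_eq_subst, Lam.shift_eq_subst, Term.frame_subst]

theorem Term.cpsE_subst_scons (M : Term) (ρ κ : ℕ → Lam) (K u : Lam) :
    (M.cpsE (Lam.ups ρ) (wk κ) K.shift).subst (scons u .var) = M.cpsE (scons u ρ) κ K := by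
  simp only [Term.cpsE_subst, Lam.ups_subst_scons, wk_subst_scons, Lam.subst_var,
    Lam.shift_subst_scons]

theorem Jump.cpsE_subst_scons (J : Jump) (ρ κ : ℕ → Lam) (u : Lam) :
    (J.cpsE (wk ρ) (Lam.ups κ)).subst (scons u .var) = J.cpsE ρ (scons u κ) := by
  simp only [Jump.cpsE_subst, Lam.ups_subst_scons, wk_subst_scons, Lam.subst_var]

theorem WStep.mu (J : Jump) (ρ κ : ℕ → Lam) (K : Lam) :
    WStep ((Term.mu J).cpsE ρ κ K) (J.cpsE ρ (scons K κ)) := by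
  rw [← Jump.cpsE_subst_scons]
  exact WStep.beta _ _

/-! ### Renaming in the source -/

@[simp] theorem Term.isValue_rename (M : Term) (ξ ζ : ℕ → ℕ) :
    (M.rename ξ ζ).isValue = M.isValue := by
  cases M <;> rfl

theorem wk_comp (ρ : ℕ → Lam) (ξ : ℕ → ℕ) : (fun n => wk ρ (ξ n)) = wk fun n => ρ (ξ n) := rfl

mutual
theorem Term.cpsE_rename (M : Term) (ξ ζ : ℕ → ℕ) (ρ κ : ℕ → Lam) (K : Lam) :
    (M.rename ξ ζ).cpsE ρ κ K = M.cpsE (fun n => ρ (ξ n)) (fun n => κ (ζ n)) K := by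
  match M with
  | .var x => rfl
  | .lam M =>
    simp only [Term.rename, Term.cpsE, Term.cpsE_rename M, wk_comp, Lam.ups_comp_upr]
  | .app M N =>
    simp only [Term.rename, Term.cpsE, Term.cpsE_rename M, Term.cpsE_rename N,
      Term.starE_rename M, Term.starE_rename N, wk_comp, Term.isValue_rename]
  | .letT L M =>
    simp only [Term.rename, Term.cpsE, Term.cpsE_rename M, Term.cpsE_rename L, wk_comp,
      Lam.ups_comp_upr]
  | .mu J =>
    simp only [Term.rename, Term.cpsE, Jump.cpsE_rename J, wk_comp, Lam.ups_comp_upr]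
theorem Term.starE_rename (M : Term) (ξ ζ : ℕ → ℕ) (ρ κ : ℕ → Lam) :
    (M.rename ξ ζ).starE ρ κ = M.starE (fun n => ρ (ξ n)) fun n => κ (ζ n) := by
  match M with
  | .var x => rfl
  | .lam M =>
    simp only [Term.rename, Term.starE, Term.cpsE_rename M, wk_comp, Lam.ups_comp_upr]
  | .app M N => rfl
  | .letT L M => rfl
  | .mu J => rfl
theorem Jump.cpsE_rename (J : Jump) (ξ ζ : ℕ → ℕ) (ρ κ : ℕ → Lam) :
    (J.rename ξ ζ).cpsE ρ κ = J.cpsE (fun n => ρ (ξ n)) fun n => κ (ζ n) := by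
  match J with
  | .jmp k M => simp only [Jump.rename, Jump.cpsE, Term.cpsE_rename M]
  | .letJ J M =>
    simp only [Jump.rename, Jump.cpsE, Term.cpsE_rename M, Jump.cpsE_rename J, wk_comp,
      Lam.ups_comp_upr]
end

theorem Term.frame_rename (M : Term) (ξ ζ : ℕ → ℕ) (ρ κ : ℕ → Lam) (c : Lam) :
    (M.rename (upr ξ) ζ).frame ρ κ c = M.frame (fun n => ρ (ξ n)) (fun n => κ (ζ n)) c := by
  simp only [Term.frame, Term.cpsE_rename, wk_comp, Lam.ups_comp_upr]

theorem Jump.cpsE_instC (J : Jump) (l : ℕ) (ρ κ : ℕ → Lam) :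
    (J.instC l).cpsE ρ κ = J.cpsE ρ (scons (κ l) κ) := by
  rw [Jump.instC, Jump.cpsE_rename]
  congr 1
  funext n
  cases n <;> rfl

/-! ### Substitution of values in the source -/

theorem ups_isValue {τ : ℕ → Term} (hτ : ∀ n, (τ n).isValue = true) (n : ℕ) :
    (ups τ n).isValue = true := by
  cases n with
  | zero => rfl
  | succ n => simpa [ups, Term.shiftO] using hτ n

theorem Term.isValue_subst (M : Term) {τ : ℕ → Term} (hτ : ∀ n, (τ n).isValue = true) :
    (M.subst τ).isValue = M.isValue := by
  cases M <;> first | rfl | exact hτ _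

theorem starE_ups {τ : ℕ → Term} (hτ : ∀ n, (τ n).isValue = true) (ρ κ : ℕ → Lam) :
    (fun n => (ups τ n).starE (Lam.ups ρ) (wk κ)) = Lam.ups fun n => (τ n).starE ρ κ := by
  funext n
  cases n with
  | zero => rfl
  | succ n =>
    simp only [ups, Term.shiftO, Term.starE_rename, Lam.ups_succ, Term.starE_shift (hτ n)]
    rfl

theorem starE_wk {τ : ℕ → Term} (hτ : ∀ n, (τ n).isValue = true) (ρ κ : ℕ → Lam) :
    (fun n => (τ n).starE (wk ρ) (wk κ)) = wk fun n => (τ n).starE ρ κ := by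
  funext n
  exact (Term.starE_shift (hτ n) _ _).symm

theorem starE_shiftC (τ : ℕ → Term) (ρ κ : ℕ → Lam) :
    (fun n => (τ n).shiftC.starE ρ (Lam.ups κ)) = fun n => (τ n).starE ρ (wk κ) := by
  funext n
  rw [Term.shiftC, Term.starE_rename]
  rfl

mutual
-- Substituting values keeps values and non-values apart, so the same clause of the translation
-- applies before and after.
theorem Term.subst_cpsE (M : Term) {τ : ℕ → Term} (hτ : ∀ n, (τ n).isValue = true)
    (ρ κ : ℕ → Lam) (K : Lam) :
    (M.subst τ).cpsE ρ κ K = M.cpsE (fun n => (τ n).starE ρ κ) κ K := by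
  match M with
  | .var x => exact Term.cpsE_value (hτ x) _ _ _
  | .lam M =>
    simp only [Term.subst, Term.cpsE, Term.subst_cpsE M (ups_isValue hτ),
      starE_wk (ups_isValue hτ), starE_ups hτ]
  | .app M N =>
    have hM := Term.subst_starE M hτ
    have hN := Term.subst_starE N hτ
    rcases hm : M.isValue <;> rcases hn : N.isValue <;>
      simp only [Term.subst, Term.cpsE, Term.subst_cpsE M hτ, Term.subst_cpsE N hτ, hm, hn, hM,
        hN, Term.isValue_subst _ hτ, starE_wk hτ]
  | .letT L M =>
    simp only [Term.subst, Term.cpsE, Term.subst_cpsE M hτ, Term.subst_cpsE L (ups_isValue hτ),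
      starE_ups hτ]
  | .mu J =>
    have hτ' : ∀ n, (τ n).shiftC.isValue = true := by simpa [Term.shiftC] using hτ
    simp only [Term.subst, Term.cpsE, Jump.subst_cpsE J hτ', starE_shiftC, starE_wk hτ]
theorem Term.subst_starE (M : Term) {τ : ℕ → Term} (hτ : ∀ n, (τ n).isValue = true)
    (hM : M.isValue = true) (ρ κ : ℕ → Lam) :
    (M.subst τ).starE ρ κ = M.starE (fun n => (τ n).starE ρ κ) κ := by
  match M with
  | .var x => rfl
  | .lam M =>
    simp only [Term.subst, Term.starE, Term.subst_cpsE M (ups_isValue hτ),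
      starE_wk (ups_isValue hτ), starE_ups hτ]
theorem Jump.subst_cpsE (J : Jump) {τ : ℕ → Term} (hτ : ∀ n, (τ n).isValue = true)
    (ρ κ : ℕ → Lam) :
    (J.subst τ).cpsE ρ κ = J.cpsE (fun n => (τ n).starE ρ κ) κ := by
  match J with
  | .jmp k M => simp only [Jump.subst, Jump.cpsE, Term.subst_cpsE M hτ]
  | .letJ J M =>
    simp only [Jump.subst, Jump.cpsE, Term.subst_cpsE M hτ, Jump.subst_cpsE J (ups_isValue hτ),
      starE_ups hτ]
end

theorem Term.cpsE_inst (M : Term) {V : Term} (hV : V.isValue = true) (ρ κ : ℕ → Lam) (K : Lam) :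
    (M.inst V).cpsE ρ κ K = M.cpsE (scons (V.starE ρ κ) ρ) κ K := by
  rw [Term.inst, Term.subst_cpsE]
  · congr 1
    funext n
    cases n <;> rfl
  · intro n
    cases n
    · exact hV
    · rfl

/-! ### Context substitution in the source -/

@[simp] theorem Term.isValue_ctxSubst (N : Term) (k : ℕ) (M : Term) :
    (N.ctxSubst k M).isValue = N.isValue := by
  cases N <;> rfl

/-- The continuation environment after the context substitution `{[k]□ ↦ [k](M x:=□)}`. -/
def ctxEnv (k : ℕ) (M : Term) (ρ κ : ℕ → Lam) : ℕ → Lam :=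
  Function.update κ k (M.frame ρ κ (κ k))

theorem ctxEnv_wk (k : ℕ) (M : Term) (ρ κ : ℕ → Lam) :
    ctxEnv k M (wk ρ) (wk κ) = wk (ctxEnv k M ρ κ) := by
  funext n
  simp only [ctxEnv, wk, Function.update_apply]
  split_ifs
  · exact (Term.frame_shift _ _ _ _).symm
  · rfl

theorem ctxEnv_rename (k : ℕ) (M : Term) (ρ κ : ℕ → Lam) :
    ctxEnv k (M.rename (upr Nat.succ) id) (Lam.ups ρ) κ = ctxEnv k M (wk ρ) κ := by
  simp only [ctxEnv, Term.frame_rename]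
  rfl

theorem ctxEnv_shiftC (k : ℕ) (M : Term) (ρ κ : ℕ → Lam) :
    ctxEnv (k + 1) M.shiftC (wk ρ) (Lam.ups κ) = Lam.ups (ctxEnv k M ρ κ) := by
  have h : M.shiftC.frame (wk ρ) (Lam.ups κ) (κ k).shift = (M.frame ρ κ (κ k)).shift := by
    have hu : (id : ℕ → ℕ) = upr id := by
      funext n
      cases n <;> rfl
    rw [Term.frame_shift, Term.shiftC, hu, Term.frame_rename]
    rfl
  funext n
  cases n with
  | zero => simp [ctxEnv]
  | succ n =>
    simp only [ctxEnv, Lam.ups_succ, Function.update_apply, Nat.add_right_cancel_iff]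
    split_ifs
    · exact h
    · rfl

mutual
-- Since ⟨[k](M x:=Q)⟩ = ⟨Q⟩[λx.⟨M⟩[k]], the context substitution amounts to replacing the
-- continuation k by λx.⟨M⟩[k].
theorem Term.ctxSubst_cpsE (N : Term) (k : ℕ) (M : Term) (ρ κ : ℕ → Lam) (K : Lam) :
    (N.ctxSubst k M).cpsE ρ κ K = N.cpsE ρ (ctxEnv k M ρ κ) K := by
  match N with
  | .var x => rfl
  | .lam N =>
    simp only [Term.ctxSubst, Term.cpsE, Term.ctxSubst_cpsE N]
    rw [ctxEnv_wk k _ (Lam.ups ρ) (wk κ), ctxEnv_rename, ctxEnv_wk]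
  | .app N P =>
    simp only [Term.ctxSubst, Term.cpsE, Term.ctxSubst_cpsE N, Term.ctxSubst_cpsE P,
      Term.ctxSubst_starE N, Term.ctxSubst_starE P, Term.isValue_ctxSubst, ctxEnv_wk]
  | .letT L N =>
    simp only [Term.ctxSubst, Term.cpsE, Term.ctxSubst_cpsE N, Term.ctxSubst_cpsE L,
      ctxEnv_rename, ctxEnv_wk]
  | .mu J =>
    simp only [Term.ctxSubst, Term.cpsE, Jump.ctxSubst_cpsE J, ctxEnv_shiftC]
theorem Term.ctxSubst_starE (N : Term) (k : ℕ) (M : Term) (ρ κ : ℕ → Lam) :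
    (N.ctxSubst k M).starE ρ κ = N.starE ρ (ctxEnv k M ρ κ) := by
  match N with
  | .var x => rfl
  | .lam N =>
    simp only [Term.ctxSubst, Term.starE, Term.ctxSubst_cpsE N]
    rw [ctxEnv_wk k _ (Lam.ups ρ) (wk κ), ctxEnv_rename, ctxEnv_wk]
  | .app N P => rfl
  | .letT L N => rfl
  | .mu J => rfl
theorem Jump.ctxSubst_cpsE (J : Jump) (k : ℕ) (M : Term) (ρ κ : ℕ → Lam) :
    (J.ctxSubst k M).cpsE ρ κ = J.cpsE ρ (ctxEnv k M ρ κ) := by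
  match J with
  | .jmp l N =>
    by_cases h : l = k
    · subst h
      simp only [Jump.ctxSubst, if_true, Jump.cpsE, Term.cpsE, Term.ctxSubst_cpsE N]
      congr 1
      simp [ctxEnv, Term.frame]
    · simp [Jump.ctxSubst, h, Jump.cpsE, Term.ctxSubst_cpsE N, ctxEnv]
  | .letJ J N =>
    simp only [Jump.ctxSubst, Jump.cpsE, Term.ctxSubst_cpsE N, Jump.ctxSubst_cpsE J,
      ctxEnv_rename, ctxEnv_wk]
end

/-! ### Bracketings of a term have beta-equal translations -/

theorem Lam.BetaEq.subst_congr (t : Lam) {σ τ : ℕ → Lam} (h : ∀ n, Lam.BetaEq (σ n) (τ n)) :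
    Lam.BetaEq (t.subst σ) (t.subst τ) := by
  induction t generalizing σ τ with
  | var x => exact h x
  | lam t ih =>
    refine (ih fun n => ?_).lam
    cases n with
    | zero => exact Lam.BetaEq.refl _
    | succ n => exact (h n).shift
  | app t u iht ihu => exact (iht h).app (ihu h)

/-- The continuation is a parameter: translate with a fresh variable in its place, then substitute.
-/
theorem Term.cpsE_congr (M : Term) (ρ κ : ℕ → Lam) {K K' : Lam} (h : Lam.BetaEq K K') :
    Lam.BetaEq (M.cpsE ρ κ K) (M.cpsE ρ κ K') := by
  have key (K : Lam) : M.cpsE ρ κ K = (M.cpsE (wk ρ) (wk κ) (.var 0)).subst (scons K .var) := by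
    simp only [Term.cpsE_subst, wk_subst_scons, Lam.subst_var, Lam.subst, Lam.scons_zero]
  rw [key K, key K']
  refine Lam.BetaEq.subst_congr _ fun n => ?_
  cases n with
  | zero => exact h
  | succ n => exact Lam.BetaEq.refl _

mutual
-- Of the three generating equations, only the one moving a let under μ needs β; the other two have
-- identical translations. Being a value and V* are carried along because the clauses for
-- applications depend on them.
theorem Term.BracketEq.cpsE_betaEq {M M' : Term} (h : Term.BracketEq M M') :
    M.isValue = M'.isValue ∧ ∀ ρ κ, Lam.BetaEq (M.starE ρ κ) (M'.starE ρ κ) ∧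
      ∀ K, Lam.BetaEq (M.cpsE ρ κ K) (M'.cpsE ρ κ K) := by
  match h with
  | .refl M => exact ⟨rfl, fun _ _ => ⟨Lam.BetaEq.refl _, fun _ => Lam.BetaEq.refl _⟩⟩
  | .symm h =>
    obtain ⟨hv, h⟩ := h.cpsE_betaEq
    exact ⟨hv.symm, fun ρ κ => ⟨(h ρ κ).1.symm, fun K => ((h ρ κ).2 K).symm⟩⟩
  | .trans h h' =>
    obtain ⟨hv, h⟩ := h.cpsE_betaEq
    obtain ⟨hv', h'⟩ := h'.cpsE_betaEq
    exact ⟨hv.trans hv', fun ρ κ =>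
      ⟨(h ρ κ).1.trans (h' ρ κ).1, fun K => ((h ρ κ).2 K).trans ((h' ρ κ).2 K)⟩⟩
  | .lam h =>
    obtain ⟨-, h⟩ := h.cpsE_betaEq
    exact ⟨rfl, fun ρ κ => ⟨((h _ _).2 _).lam.lam,
      fun K => (Lam.BetaEq.refl K).app ((h _ _).2 _).lam.lam⟩⟩
  | .app (M := M) (M' := M') (N := N) (N' := N') h h' =>
    obtain ⟨hv, h⟩ := h.cpsE_betaEq
    obtain ⟨hv', h'⟩ := h'.cpsE_betaEq
    refine ⟨rfl, fun ρ κ => ⟨Lam.BetaEq.refl _, fun K => ?_⟩⟩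
    simp only [Term.cpsE, hv, hv']
    split
    · exact ((h _ _).1.app (h' _ _).1).app (Lam.BetaEq.refl _)
    · exact ((h' _ _).2 _).trans (Term.cpsE_congr _ _ _
        (((h _ _).1.shift.app (Lam.BetaEq.refl _)).app (Lam.BetaEq.refl _)).lam)
    · exact ((h _ _).2 _).trans (Term.cpsE_congr _ _ _
        (((Lam.BetaEq.refl _).app (h' _ _).1.shift).app (Lam.BetaEq.refl _)).lam)
    · exact ((h _ _).2 _).trans (Term.cpsE_congr _ _ _ ((h' _ _).2 _).lam)
  | .letT h h' =>
    obtain ⟨-, h⟩ := h.cpsE_betaEq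
    obtain ⟨-, h'⟩ := h'.cpsE_betaEq
    exact ⟨rfl, fun ρ κ => ⟨Lam.BetaEq.refl _, fun K =>
      ((h' _ _).2 _).trans (Term.cpsE_congr _ _ _ ((h _ _).2 _).lam)⟩⟩
  | .mu h =>
    exact ⟨rfl, fun ρ κ => ⟨Lam.BetaEq.refl _, fun K =>
      (h.cpsE_betaEq _ _).lam.app (Lam.BetaEq.refl K)⟩⟩
  | .assoc L M N =>
    refine ⟨rfl, fun ρ κ => ⟨Lam.BetaEq.refl _, fun K => Lam.BetaEq.of_eq ?_⟩⟩
    change N.cpsE ρ κ (.lam (M.cpsE _ _ (L.frame ρ κ K).shift)) = N.cpsE ρ κ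
      (.lam (M.cpsE _ _ ((L.rename (upr Nat.succ) id).frame (Lam.ups ρ) (wk κ) K.shift)))
    rw [Term.frame_shift, Term.frame_rename]
    rfl
  | .muLet J M =>
    refine ⟨rfl, fun ρ κ => ⟨Lam.BetaEq.refl _, fun K => ?_⟩⟩
    have henv : wk (scons K κ) = scons K.shift (wk κ) := by
      funext n
      cases n <;> rfl
    refine Lam.BetaEq.trans ?_ (WStep.mu (.letJ J M.shiftC) ρ κ K).betaEq.symm
    rw [Jump.cpsE, Term.shiftC, Term.cpsE_rename, henv]
    exact Term.cpsE_congr _ _ _ (WStep.mu J _ _ _).betaEq.lam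
theorem Jump.BracketEq.cpsE_betaEq {J J' : Jump} (h : Jump.BracketEq J J') (ρ κ : ℕ → Lam) :
    Lam.BetaEq (J.cpsE ρ κ) (J'.cpsE ρ κ) := by
  match h with
  | .refl J => exact Lam.BetaEq.refl _
  | .symm h => exact (h.cpsE_betaEq ρ κ).symm
  | .trans h h' => exact (h.cpsE_betaEq ρ κ).trans (h'.cpsE_betaEq ρ κ)
  | .jmp k h => exact (h.cpsE_betaEq.2 _ _).2 _
  | .letJ h h' =>
    exact ((h'.cpsE_betaEq.2 _ _).2 _).trans
      (Term.cpsE_congr _ _ _ (h.cpsE_betaEq _ _).lam)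
  | .jmpLet k L M => exact Lam.BetaEq.refl _
end

-- Translations of whole terms and of their readings

theorem Term.cps_eq (M : Term) :
    M.cps = .lam (M.cpsE (fun x => .var (2 * x + 1)) (fun k => .var (2 * k + 1 + 1)) (.var 0)) := by
  rw [Term.cps, Term.colon_eq_cpsE]

theorem Term.BracketEq.cps_betaEq {M M' : Term} (h : Term.BracketEq M M') :
    Lam.BetaEq M.cps M'.cps := by
  simp only [Term.cps_eq]
  exact ((h.cpsE_betaEq.2 _ _).2 _).lam

mutual
theorem Term.bracketEq_read (M : Term) : Term.BracketEq M M.read := by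
  match M with
  | .var x => exact .refl _
  | .lam M => exact .lam (Term.bracketEq_read M)
  | .app M N => exact .app (Term.bracketEq_read M) (Term.bracketEq_read N)
  | .letT L M => exact .letT (Term.bracketEq_read L) (Term.bracketEq_read M)
  | .mu J => exact .mu (Jump.bracketEq_read J)
theorem Jump.bracketEq_read (J : Jump) : Jump.BracketEq J (.jmp J.read.1 J.read.2) := by
  match J with
  | .jmp k M => exact .jmp k (Term.bracketEq_read M)
  | .letJ J M =>
    exact .trans (.letJ (Jump.bracketEq_read J) (Term.bracketEq_read M)) (.symm (.jmpLet _ _ _))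
end

end CCV

namespace CCV

open Lam (scons wk WStep WBound)

/-! ### Simulation of evaluation by weak head reduction -/

/-- Two terms that are equal or have a common weak head reduct. -/
def Lam.LazyStep (a b : Lam) : Prop := a = b ∨ ∃ c, WStep a c ∧ WStep b c

/-- The second term is, up to a `LazyStep`, a proper weak head reduct of the first. -/
def Lam.ActiveStep (a b : Lam) : Prop :=
  ∃ a', WStep a a' ∧ (ReflTransGen WStep a' b ∨ ∃ c, WStep a' c ∧ WStep b c)

theorem Lam.LazyStep.betaEq {a b : Lam} (h : Lam.LazyStep a b) : Lam.BetaEq a b := by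
  obtain rfl | ⟨c, ha, hb⟩ := h
  · exact Lam.BetaEq.refl _
  · exact ha.betaEq.trans hb.betaEq.symm

theorem Lam.ActiveStep.betaEq {a b : Lam} (h : Lam.ActiveStep a b) : Lam.BetaEq a b := by
  obtain ⟨a', ha, h | ⟨c, ha', hb⟩⟩ := h
  · refine ha.betaEq.trans ?_
    clear ha
    induction h with
    | refl => exact Lam.BetaEq.refl _
    | tail _ h ih => exact ih.trans h.betaEq
  · exact ha.betaEq.trans (ha'.betaEq.trans hb.betaEq.symm)

theorem Lam.LazyStep.wbound {a b : Lam} (h : Lam.LazyStep a b) {n : ℕ} (hn : WBound n a) :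
    WBound n b := by
  obtain rfl | ⟨c, ha, hb⟩ := h
  · exact hn
  · obtain ⟨m, rfl, hm⟩ := hn.step ha
    exact hm.of_step hb

theorem Lam.ActiveStep.wbound {a b : Lam} (h : Lam.ActiveStep a b) {n : ℕ} (hn : WBound n a) :
    ∃ m < n, WBound m b := by
  obtain ⟨a', ha, h⟩ := h
  obtain ⟨m, rfl, hm⟩ := hn.step ha
  obtain h | ⟨c, ha', hb⟩ := h
  · obtain ⟨k, hk, h⟩ := hm.steps h
    exact ⟨k, by omega, h⟩
  · obtain ⟨k, rfl, hk⟩ := hm.step ha'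
    exact ⟨k + 1, by omega, hk.of_step hb⟩

/-- An evaluation context acts as a continuation. On non-values the agreement is literal. On values
it holds up to weak head reduction, because the translation of applications has already contracted
the administrative redex that passes V* to K'. -/
theorem EvalCtx.exists_cont (E : EvalCtx) (ρ κ : ℕ → Lam) (K : Lam) :
    ∃ K', (∀ N, N.isValue = false → (E.fill N).cpsE ρ κ K = N.cpsE ρ κ K') ∧
      ∀ W, W.isValue = true → ReflTransGen WStep (W.cpsE ρ κ K') ((E.fill W).cpsE ρ κ K) := by
  induction E with
  | hole => exact ⟨K, fun _ _ => rfl, fun _ _ => .refl⟩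
  | argOf E V hV ih =>
    obtain ⟨K', h, -⟩ := ih
    refine ⟨.lam (.app (.app (V.starE ρ κ).shift (.var 0)) K'.shift), fun N hN => ?_,
      fun W hW => ?_⟩
    · rw [EvalCtx.fill, h _ rfl, Term.cpsE, hV, hN]
    · rw [EvalCtx.fill, h _ rfl, Term.cpsE_value hW, Term.cpsE, hV, hW]
      convert ReflTransGen.single (WStep.beta _ _) using 1
      simp [Lam.subst]
  | funOf E M ih =>
    obtain ⟨K', h, -⟩ := ih
    rcases hM : M.isValue
    · refine ⟨.lam (M.cpsE (wk ρ) (wk κ) (.lam (.app (.app (.var 1) (.var 0)) K'.shift.shift))),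
        fun N hN => ?_, fun W hW => ?_⟩
      · rw [EvalCtx.fill, h _ rfl, Term.cpsE, hM, hN]
      · rw [EvalCtx.fill, h _ rfl, Term.cpsE_value hW, Term.cpsE, hM, hW]
        convert ReflTransGen.single (WStep.beta _ _) using 1
        simp [Lam.subst, Term.cpsE_subst, wk_subst_scons, Lam.ups]
    · refine ⟨.lam (.app (.app (.var 0) (M.starE ρ κ).shift) K'.shift), fun N hN => ?_,
        fun W hW => ?_⟩
      · rw [EvalCtx.fill, h _ rfl, Term.cpsE, hM, hN]
      · rw [EvalCtx.fill, h _ rfl, Term.cpsE_value hW, Term.cpsE, hM, hW]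
        convert ReflTransGen.single (WStep.beta _ _) using 1
        simp [Lam.subst]
  | letOf E M ih =>
    obtain ⟨K', h, -⟩ := ih
    exact ⟨M.frame ρ κ K', fun N _ => h _ rfl, fun W _ => by rw [EvalCtx.fill, h _ rfl]; rfl⟩

/-- The depth of the evaluation position of a term. -/
def Term.weight : Term → ℕ
  | .app M N => bif M.isValue then N.weight + 2 else M.weight + 2
  | .letT _ M => M.weight + 1
  | _ => 0

theorem EvalCtx.weight_fill_lt (E : EvalCtx) {N N' : Term} (hN : N.isValue = false)
    (hN' : N'.isValue = false) (h : N.weight < N'.weight) :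
    (E.fill N).weight < (E.fill N').weight := by
  induction E generalizing N N' with
  | hole => exact h
  | argOf E V hV ih => exact ih rfl rfl (by simp [Term.weight, hV, h])
  | funOf E M ih => exact ih rfl rfl (by simp [Term.weight, hN, hN', h])
  | letOf E M ih => exact ih rfl rfl (by simp [Term.weight, h])

theorem WStep.letValue (M : Term) {V : Term} (hV : V.isValue = true) (ρ κ : ℕ → Lam) (K : Lam) :
    WStep ((Term.letT M V).cpsE ρ κ K) (M.cpsE (scons (V.starE ρ κ) ρ) κ K) := by
  rw [← Term.cpsE_subst_scons, Term.cpsE, Term.cpsE_value hV]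
  exact WStep.beta _ _

theorem WStep.mu_jmp (l : ℕ) (L : Term) (ρ κ : ℕ → Lam) (K : Lam) :
    WStep ((Term.mu (.jmp l L)).cpsE ρ κ K) (L.cpsE ρ (scons K κ) (scons K κ l)) :=
  WStep.mu _ _ _ _

theorem ctxEnv_zero_shiftC (M : Term) (ρ κ : ℕ → Lam) (K : Lam) :
    ctxEnv 0 M.shiftC ρ (scons K κ) = scons (M.frame ρ κ K) κ := by
  have h : M.shiftC.frame ρ (scons K κ) K = M.frame ρ κ K := by
    simp only [Term.frame, Term.shiftC, Term.cpsE_rename]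
    rfl
  funext n
  cases n with
  | zero => simp [ctxEnv, h]
  | succ n => simp [ctxEnv]

/-- Steps concerning μ do no real work in the target, so they must lower the weight; the two β-steps
for values perform a genuine weak head reduction, and the weight may then grow. -/
theorem E0Step.simulation {L M : Term} (h : E0Step L M) (ρ κ : ℕ → Lam) (K : Lam) :
    Lam.LazyStep (L.cpsE ρ κ K) (M.cpsE ρ κ K) ∧ M.weight < L.weight ∨
      Lam.ActiveStep (L.cpsE ρ κ K) (M.cpsE ρ κ K) := by
  cases h with
  | admin₁ E J M =>
    obtain ⟨K', h, -⟩ := E.exists_cont ρ κ K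
    -- An application frame weighs 2 and a let frame 1: turning an application to or of a μ into a
    -- let lowers 2 to 1, and absorbing the let into the μ lowers 1 to 0.
    refine .inl ⟨.inl ?_, E.weight_fill_lt rfl rfl (by simp [Term.weight, Term.isValue])⟩
    rw [h _ rfl, h _ rfl]
    have hv : (Term.var 0).isValue = true := rfl
    have hj : (Term.mu J).isValue = false := rfl
    rcases hM : M.isValue
    · simp only [Term.cpsE, hv, hj, Term.shiftO, Term.isValue_rename, hM, Term.starE,
        Term.cpsE_rename]
      rfl
    · simp only [Term.cpsE, hv, hj, Term.shiftO, Term.isValue_rename, hM, Term.starE,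
        Term.starE_rename, Term.starE_shift hM]
      rfl
  | admin₂ E V J hV =>
    obtain ⟨K', h, -⟩ := E.exists_cont ρ κ K
    refine .inl ⟨.inl ?_, E.weight_fill_lt rfl rfl (by simp [Term.weight, hV])⟩
    rw [h _ rfl, h _ rfl]
    have hv : (Term.var 0).isValue = true := rfl
    have hj : (Term.mu J).isValue = false := rfl
    simp only [Term.cpsE, hv, hj, Term.shiftO, Term.isValue_rename, hV, Term.starE,
      Term.starE_rename, Term.starE_shift hV]
    rfl
  | betaLam E M V hV =>
    obtain ⟨K', h, -⟩ := E.exists_cont ρ κ K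
    refine .inr ?_
    rw [h _ rfl, h _ rfl, Term.cpsE, hV]
    -- The application needs two weak head steps, for x and for k, to reach the term that the let
    -- reaches in one.
    refine ⟨_, (WStep.beta _ _).app _, .inr ⟨_, ?_, WStep.letValue M hV ρ κ K'⟩⟩
    have := WStep.beta ((M.cpsE (wk (Lam.ups ρ)) (wk (wk κ)) (.var 0)).subst
      (Lam.ups (scons (V.starE ρ κ) .var))) K'
    simpa only [Term.cpsE_subst, wk_subst_ups, wk_subst_scons, Lam.ups_subst_scons, Lam.subst_var,
      Lam.subst, Lam.ups_zero, Lam.scons_zero] using this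
  | betaLet E M V hV =>
    obtain ⟨K', h, h'⟩ := E.exists_cont ρ κ K
    refine .inr ?_
    rw [h _ rfl]
    refine ⟨_, WStep.letValue M hV ρ κ K', .inl ?_⟩
    rw [← Term.cpsE_inst M hV]
    rcases hM : (M.inst V).isValue
    · rw [h _ hM]
    -- The step may leave a value in the context; the value must then be passed to the surrounding
    -- continuation.
    · exact h' _ hM
  | betaMu E M J =>
    obtain ⟨K', h, -⟩ := E.exists_cont ρ κ K
    refine .inl ⟨.inr ?_, E.weight_fill_lt rfl rfl (by simp [Term.weight])⟩
    rw [h _ rfl, h _ rfl]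
    refine ⟨_, WStep.mu J ρ κ (M.frame ρ κ K'), ?_⟩
    convert WStep.mu (J.ctxSubst 0 M.shiftC) ρ κ K' using 1
    rw [Jump.ctxSubst_cpsE, ctxEnv_zero_shiftC]

-- The termination measure of evaluation

/-- Whether a term is not a `μ`-abstraction, as a number. -/
def Term.outer : Term → ℕ
  | .mu _ => 0
  | _ => 1

/-- The depth of the evaluation position of a term, possibly below a `μ`-abstraction. -/
def Term.muWeight : Term → ℕ
  | .mu (.jmp _ L) => L.weight
  | M => M.weight

theorem EvalCtx.outer_fill (E : EvalCtx) {N : Term} (hN : N.outer = 1) : (E.fill N).outer = 1 := by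
  induction E generalizing N with
  | hole => exact hN
  | argOf E V hV ih => exact ih rfl
  | funOf E M ih => exact ih rfl
  | letOf E M ih => exact ih rfl

theorem E0Step.outer {L M : Term} (h : E0Step L M) : L.outer = 1 := by
  cases h <;> exact EvalCtx.outer_fill _ rfl

theorem Term.outer_cases (M : Term) : M.outer = 0 ∨ M.outer = 1 ∧ M.muWeight = M.weight := by
  cases M <;> simp [Term.outer, Term.muWeight]

/-- The measure is lexicographic: the bound, then `outer`, then `muWeight`. The middle component is
needed because a step that brings μ to the top exposes a jump body of arbitrary weight; no top-level
`E0Step` applies to a μ-abstraction, so this does not recur while the bound is unchanged. -/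
theorem EStep.wbound {L M : Term} (h : EStep L M) (ρ κ : ℕ → Lam) (K : Lam) {n : ℕ}
    (hn : WBound n (L.cpsE ρ κ K)) :
    (WBound n (M.cpsE ρ κ K) ∧
      (M.outer < L.outer ∨ M.outer = L.outer ∧ M.muWeight < L.muWeight)) ∨
      ∃ m < n, WBound m (M.cpsE ρ κ K) := by
  cases h with
  | collapse l J =>
    obtain ⟨m, rfl, hm⟩ := hn.step (WStep.mu_jmp _ _ _ _ _)
    obtain ⟨k, rfl, hk⟩ := hm.step (WStep.mu _ _ _ _)
    -- The nested μ's take two weak head steps to the common reduct, the collapsed one takes one.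
    refine .inr ⟨k + 1, by omega, hk.of_step ?_⟩
    convert WStep.mu (J.instC l) ρ κ K using 1
    rw [Jump.cpsE_instC]
  | base h =>
    obtain ⟨hs, hw⟩ | hs := h.simulation ρ κ K
    · refine .inl ⟨hs.wbound hn, ?_⟩
      have h1 := h.outer
      obtain h0 | ⟨h2, hM⟩ := M.outer_cases
      · omega
      · obtain h3 | ⟨-, hL⟩ := L.outer_cases <;> omega
    · exact .inr (hs.wbound hn)
  | @underMu l L M h =>
    obtain ⟨m, rfl, hm⟩ := hn.step (WStep.mu_jmp _ _ _ _ _)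
    obtain ⟨hs, hw⟩ | hs := h.simulation ρ (scons K κ) (scons K κ l)
    · exact .inl ⟨(hs.wbound hm).of_step (WStep.mu_jmp _ _ _ _ _), .inr ⟨rfl, hw⟩⟩
    · obtain ⟨k, hk, h⟩ := hs.wbound hm
      exact .inr ⟨k + 1, by omega, h.of_step (WStep.mu_jmp _ _ _ _ _)⟩

theorem exists_eNormal_of_wbound (n : ℕ) (M : Term) (ρ κ : ℕ → Lam) (K : Lam)
    (hn : WBound n (M.cpsE ρ κ K)) : ∃ N, ReflTransGen EStep M N ∧ ENormal N := by
  by_cases hM : ENormal M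
  · exact ⟨M, .refl, hM⟩
  · obtain ⟨P, hP⟩ : ∃ P, EStep M P := by simpa [ENormal] using hM
    obtain ⟨N, hN, hN'⟩ : ∃ N, ReflTransGen EStep P N ∧ ENormal N := by
      obtain ⟨h, h' | h'⟩ | ⟨m, hm, h⟩ := hP.wbound ρ κ K hn
      · exact exists_eNormal_of_wbound n P ρ κ K h
      · exact exists_eNormal_of_wbound n P ρ κ K h
      · exact exists_eNormal_of_wbound m P ρ κ K h
    exact ⟨N, .head hP hN, hN'⟩
termination_by (n, M.outer, M.muWeight)
decreasing_by
  · exact .right _ (.left _ _ h')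
  · rw [h'.1]
    exact .right _ (.right _ h'.2)
  · exact .left _ _ hm

theorem EStep.cpsE_betaEq {L M : Term} (h : EStep L M) (ρ κ : ℕ → Lam) (K : Lam) :
    Lam.BetaEq (L.cpsE ρ κ K) (M.cpsE ρ κ K) := by
  have base {L M : Term} (h : E0Step L M) (ρ κ : ℕ → Lam) (K : Lam) :
      Lam.BetaEq (L.cpsE ρ κ K) (M.cpsE ρ κ K) :=
    (h.simulation ρ κ K).elim (fun h => h.1.betaEq) fun h => h.betaEq
  cases h with
  | collapse l J =>
    refine ((WStep.mu_jmp _ _ _ _ _).betaEq.trans (WStep.mu _ _ _ _).betaEq).trans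
      (Lam.BetaEq.symm ((WStep.mu _ _ _ _).betaEq.trans (Lam.BetaEq.of_eq ?_)))
    rw [Jump.cpsE_instC]
  | base h => exact base h ρ κ K
  | underMu l h =>
    exact (WStep.mu_jmp _ _ _ _ _).betaEq.trans
      ((base h _ _ _).trans (WStep.mu_jmp _ _ _ _ _).betaEq.symm)

/-! ### Terms all of whose jumps have the form `[k]M` -/

mutual
/-- All jumps in the term have the form `[k]M`. -/
def Term.Plain : Term → Prop
  | .var _ => True
  | .lam M => M.Plain
  | .app M N => M.Plain ∧ N.Plain
  | .letT L M => L.Plain ∧ M.Plain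
  | .mu J => J.Plain
/-- All jumps in the jump have the form `[k]M`. -/
def Jump.Plain : Jump → Prop
  | .jmp _ M => M.Plain
  | .letJ _ _ => False
end

mutual
-- The evaluation rules do not look inside a jump `(J x:=M)`, so a μ over such a jump is always
-- normal. Plainness, which readings have and evaluation preserves, excludes these spurious normal
-- forms.
theorem Term.plain_read (M : Term) : M.read.Plain := by
  match M with
  | .var x => trivial
  | .lam M => exact M.plain_read
  | .app M N => exact ⟨M.plain_read, N.plain_read⟩
  | .letT L M => exact ⟨L.plain_read, M.plain_read⟩
  | .mu J => exact J.plain_read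
theorem Jump.plain_read (J : Jump) : J.read.2.Plain := by
  match J with
  | .jmp k M => exact M.plain_read
  | .letJ J M => exact ⟨J.plain_read, M.plain_read⟩
end

mutual
theorem Term.Plain.rename {M : Term} (h : M.Plain) (ξ ζ : ℕ → ℕ) : (M.rename ξ ζ).Plain := by
  match M with
  | .var x => trivial
  | .lam M => exact Term.Plain.rename (M := M) h _ _
  | .app M N => exact ⟨h.1.rename _ _, h.2.rename _ _⟩
  | .letT L M => exact ⟨h.1.rename _ _, h.2.rename _ _⟩
  | .mu J => exact Jump.Plain.rename (J := J) h _ _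
theorem Jump.Plain.rename {J : Jump} (h : J.Plain) (ξ ζ : ℕ → ℕ) : (J.rename ξ ζ).Plain := by
  match J with
  | .jmp k M => exact Term.Plain.rename (M := M) h _ _
end

theorem plain_ups {τ : ℕ → Term} (hτ : ∀ n, (τ n).Plain) (n : ℕ) : (ups τ n).Plain := by
  cases n with
  | zero => trivial
  | succ n => exact (hτ n).rename _ _

mutual
theorem Term.Plain.subst {M : Term} (h : M.Plain) {τ : ℕ → Term} (hτ : ∀ n, (τ n).Plain) :
    (M.subst τ).Plain := by
  match M with
  | .var x => exact hτ x
  | .lam M => exact Term.Plain.subst (M := M) h (plain_ups hτ)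
  | .app M N => exact ⟨h.1.subst hτ, h.2.subst hτ⟩
  | .letT L M => exact ⟨h.1.subst (plain_ups hτ), h.2.subst hτ⟩
  | .mu J => exact Jump.Plain.subst (J := J) h fun n => (hτ n).rename _ _
theorem Jump.Plain.subst {J : Jump} (h : J.Plain) {τ : ℕ → Term} (hτ : ∀ n, (τ n).Plain) :
    (J.subst τ).Plain := by
  match J with
  | .jmp k M => exact Term.Plain.subst (M := M) h hτ
end

mutual
theorem Term.Plain.ctxSubst {N : Term} (h : N.Plain) (k : ℕ) {M : Term} (hM : M.Plain) :
    (N.ctxSubst k M).Plain := by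
  match N with
  | .var x => trivial
  | .lam N => exact Term.Plain.ctxSubst (N := N) h _ (hM.rename _ _)
  | .app N P => exact ⟨h.1.ctxSubst k hM, h.2.ctxSubst k hM⟩
  | .letT L N => exact ⟨h.1.ctxSubst k (hM.rename _ _), h.2.ctxSubst k hM⟩
  | .mu J => exact Jump.Plain.ctxSubst (J := J) h _ (hM.rename _ _)
theorem Jump.Plain.ctxSubst {J : Jump} (h : J.Plain) (k : ℕ) {M : Term} (hM : M.Plain) :
    (J.ctxSubst k M).Plain := by
  match J with
  | .jmp l N =>
    have h' := Term.Plain.ctxSubst (N := N) h k hM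
    rw [Jump.ctxSubst]
    split_ifs
    · exact ⟨hM, h'⟩
    · exact h'
end

theorem EvalCtx.plain_fill (E : EvalCtx) {N : Term} (h : (E.fill N).Plain) :
    N.Plain ∧ ∀ N', N'.Plain → (E.fill N').Plain := by
  induction E generalizing N with
  | hole => exact ⟨h, fun _ h => h⟩
  | argOf E V hV ih =>
    obtain ⟨⟨hV, hN⟩, h⟩ := ih h
    exact ⟨hN, fun N' hN' => h _ ⟨hV, hN'⟩⟩
  | funOf E M ih =>
    obtain ⟨⟨hN, hM⟩, h⟩ := ih h
    exact ⟨hN, fun N' hN' => h _ ⟨hN', hM⟩⟩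
  | letOf E M ih =>
    obtain ⟨⟨hM, hN⟩, h⟩ := ih h
    exact ⟨hN, fun N' hN' => h _ ⟨hM, hN'⟩⟩

theorem E0Step.plain {L M : Term} (h : E0Step L M) (hL : L.Plain) : M.Plain := by
  cases h with
  | admin₁ E J M =>
    obtain ⟨⟨hJ, hM⟩, h⟩ := E.plain_fill hL
    exact h _ ⟨⟨trivial, hM.rename _ _⟩, hJ⟩
  | admin₂ E V J hV =>
    obtain ⟨⟨hV, hJ⟩, h⟩ := E.plain_fill hL
    exact h _ ⟨⟨hV.rename _ _, trivial⟩, hJ⟩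
  | betaLam E M V hV =>
    obtain ⟨⟨hM, hV⟩, h⟩ := E.plain_fill hL
    exact h _ ⟨hM, hV⟩
  | betaLet E M V hV =>
    obtain ⟨⟨hM, hV⟩, h⟩ := E.plain_fill hL
    refine h _ (hM.subst fun n => ?_)
    cases n
    · exact hV
    · trivial
  | betaMu E M J =>
    obtain ⟨⟨hM, hJ⟩, h⟩ := E.plain_fill hL
    exact h _ (Jump.Plain.ctxSubst hJ 0 (hM.rename _ _))

theorem EStep.plain {L M : Term} (h : EStep L M) (hL : L.Plain) : M.Plain := by
  cases h with
  | collapse l J => exact Jump.Plain.rename (J := J) hL _ _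
  | base h => exact h.plain hL
  | underMu l h => exact h.plain hL

/-! ### Normal forms of the evaluation -/

/-- The search for a redex moves down the evaluation position and transfers the surrounding frames
to `F`. It can only get stuck at a variable applied to a value. -/
theorem Term.progress (L : Term) (F : EvalCtx) :
    (∃ P, E0Step (F.fill L) P) ∨ L.isValue = true ∨ (∃ J, L = .mu J) ∨
      ∃ (E : EvalCtx) (x : ℕ) (V : Term), V.isValue = true ∧
        F.fill L = E.fill (.app (.var x) V) := by
  match L with
  | .var x => exact .inr (.inl rfl)
  | .lam M => exact .inr (.inl rfl)
  | .mu J => exact .inr (.inr (.inl ⟨J, rfl⟩))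
  | .letT M N =>
    obtain h | h | ⟨J, rfl⟩ | h := N.progress (.letOf F M)
    · exact .inl h
    · exact .inl ⟨_, .betaLet F M N h⟩
    · exact .inl ⟨_, .betaMu F M J⟩
    · exact .inr (.inr (.inr h))
  | .app M N =>
    obtain h | hM | ⟨J, rfl⟩ | h := M.progress (.funOf F N)
    · exact .inl h
    · obtain h | hN | ⟨J, rfl⟩ | h := N.progress (.argOf F M hM)
      · exact .inl h
      · match M, hM with
        | .var x, _ => exact .inr (.inr (.inr ⟨F, x, N, hN, rfl⟩))
        | .lam M, _ => exact .inl ⟨_, .betaLam F M N hN⟩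
      · exact .inl ⟨_, .admin₂ F M J hM⟩
      · exact .inr (.inr (.inr h))
    · exact .inl ⟨_, .admin₁ F J N⟩
    · exact .inr (.inr (.inr h))

theorem Term.neutral_cpsE {L : Term} (h : ∀ P, ¬ E0Step L P) (hmu : ∀ J, L ≠ .mu J)
    {ρ κ : ℕ → Lam} {K : Lam} (hρ : ∀ n, (ρ n).Neutral) (hK : K.Neutral) :
    (L.cpsE ρ κ K).Neutral := by
  obtain ⟨P, hP⟩ | hV | ⟨J, hJ⟩ | ⟨E, x, V, hV, hL⟩ := L.progress .hole
  · exact (h P hP).elim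
  · rw [Term.cpsE_value hV]
    exact hK.app _
  · exact (hmu J hJ).elim
  · rw [EvalCtx.fill] at hL
    obtain ⟨K', h, -⟩ := E.exists_cont ρ κ K
    rw [hL, h _ rfl, Term.cpsE, hV]
    exact ((hρ x).app _).app _

theorem ENormal.exists_neutral {N : Term} (h : ENormal N) (hN : N.Plain) {ρ κ : ℕ → Lam} {K : Lam}
    (hρ : ∀ n, (ρ n).Neutral) (hκ : ∀ n, (κ n).Neutral) (hK : K.Neutral) :
    ∃ t, Lam.BetaEq (N.cpsE ρ κ K) t ∧ t.Neutral := by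
  by_cases hmu : ∃ J, N = .mu J
  · obtain ⟨⟨l, L⟩ | ⟨J, M⟩, rfl⟩ := hmu
    · refine ⟨_, (WStep.mu _ _ _ _).betaEq, Term.neutral_cpsE (fun P hP => h _ (.underMu l hP)) ?_
        hρ ?_⟩
      · rintro J rfl
        -- Below the μ the jump body is not itself a μ, for otherwise the two would collapse.
        exact h _ (.collapse l J)
      · cases l with
        | zero => exact hK
        | succ l => exact hκ l
    · exact hN.elim
  · exact ⟨_, Lam.BetaEq.refl _, Term.neutral_cpsE (fun P hP => h _ (.base hP))
      (fun J hJ => hmu ⟨J, hJ⟩) hρ hK⟩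

-- Termination, head normal forms and solvability

theorem EvalTerminates.hasHNF {M : Term} (h : EvalTerminates M) : M.cps.HasHNF := by
  obtain ⟨N, hN, hN'⟩ := h
  have key : N.Plain ∧ Lam.BetaEq M.read.cps N.cps := by
    clear hN'
    induction hN with
    | refl => exact ⟨M.plain_read, Lam.BetaEq.refl _⟩
    | tail _ h ih =>
      refine ⟨h.plain ih.1, ih.2.trans ?_⟩
      simp only [Term.cps_eq]
      exact (h.cpsE_betaEq _ _ _).lam
  obtain ⟨t, ht, hn⟩ := hN'.exists_neutral key.1 (ρ := fun x => .var (2 * x + 1))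
    (κ := fun k => .var (2 * k + 1 + 1)) (K := .var 0) (fun _ => .var _) (fun _ => .var _) (.var _)
  obtain ⟨y, us, rfl⟩ := hn.eq_apps
  refine ⟨_, M.bracketEq_read.cps_betaEq.trans (key.2.trans ?_), 1, y, us, rfl⟩
  rw [Term.cps_eq]
  exact ht.lam

theorem evalTerminates_of_solvable {M M' : Term} (hM : Term.BracketEq M M')
    (h : M'.cps.Solvable) : EvalTerminates M := by
  obtain ⟨Γ, h⟩ := h.nonempty_den
  -- The model carries typability from the translation of `M'` to that of the reading of `M`; a
  -- bound on weak head reduction need not be invariant under β-equality.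
  rw [← (M.bracketEq_read.symm.trans hM).cps_betaEq.den_eq, Term.cps_eq] at h
  obtain ⟨Δ, h⟩ := Lam.nonempty_den_of_lams (n := 1) h
  obtain ⟨n, hn⟩ := Lam.exists_wbound h
  exact exists_eNormal_of_wbound n _ _ _ _ hn

theorem Lam.HasHNF.of_betaEq {t u : Lam} (h : t.HasHNF) (htu : Lam.BetaEq t u) : u.HasHNF := by
  obtain ⟨v, hv, hnf⟩ := h
  exact ⟨v, htu.symm.trans hv, hnf⟩

end CCV

theorem mainTheorem4 (M M' : CCV.Term) (hM : CCV.Term.BracketEq M M') :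
    (CCV.EvalTerminates M ↔ M'.cps.Solvable) ∧ (M'.cps.Solvable ↔ M'.cps.HasHNF) := by
  have h (h : CCV.EvalTerminates M) : M'.cps.HasHNF := h.hasHNF.of_betaEq hM.cps_betaEq
  have h' (h : M'.cps.Solvable) : CCV.EvalTerminates M := CCV.evalTerminates_of_solvable hM h
  exact ⟨⟨fun ht => (h ht).solvable, h'⟩, fun hs => h (h' hs), fun hn => hn.solvable⟩
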